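/- Let $\mathcal X,\mathcal Y,\mathcal Z$ be finite alphabets and let $p(y,z|x)$ be a discrete memoryless channel with input $X$, output $Y$ at the intended receiver and output $Z$ at a side receiver; it is used without feedback, so that $p(y^n,z^n|x^n)=\prod_{i=1}^n p(y_i,z_i|x_i)$. Logarithms have base $2$. For $R\ge 0$ and $n\ge 1$, a $(2^{nR},n)$ code consists of the message set $\{1,\dots,\lceil 2^{nR}\rceil\}$, an encoding function $x^n:\{1,\dots,\lceil 2^{nR}\rceil\}\to\mathcal X^n$ and a decoding function $\hat m:\mathcal Y^n\to\{1,\dots,\lceil 2^{nR}\rceil\}$. The message $M$ is uniformly distributed on the message set, $X^n=x^n(M)$ is sent over the channel, the outputs are $Y^n$ and $Z^n$, and $\hat M=\hat m(Y^n)$. A pair $(R,R_{\mathrm d})$ with $R\ge 0$, $R_{\mathrm d}\ge 0$ is achievable if there is a sequence of $(2^{nR},n)$ codes such that $$\lim_{n\to\infty}\mathsf P(\hat M\ne M)=0,\qquad \limsup_{n\to\infty}\tfrac1n I(X^n;Z^n)\le R_{\mathrm d}.$$ The rate--disturbance region $\mathscr R$ is the closure of the set of all achievable pairs. **Theorem.**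 The rate--disturbance region $\mathscr R$ is exactly the set of all pairs $(R,R_{\mathrm d})$ with $R\ge 0$, $R_{\mathrm d}\ge 0$ such that $$R\le I(X;Y),\qquad R_{\mathrm d}\ge I(X;Z\,|\,U),\qquad R-R_{\mathrm d}\le I(X;Y\,|\,U)-I(X;Z\,|\,U)$$ for some finite set $\mathcal U$ with $|\mathcal U|\le|\mathcal X|+1$ and some pmf $p(u,x)$ on $\mathcal U\times\mathcal X$, where $(U,X,Y,Z)$ has joint pmf $p(u,x)\,p(y,z|x)$. -/

import Mathlib

namespace DisturbanceChannel

/-! ### Information measures of random variables on a finite probability space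

A probability space is a finite type `Ω` with a pmf `μ : Ω → ℝ` (an element of `stdSimplex ℝ Ω`);
a random variable is a function on `Ω` with values in a finite type. All logarithms have base 2. -/

section Information

variable {Ω A B C : Type*} [Fintype Ω] [Fintype A] [Fintype B] [Fintype C]

open Classical in
/-- The pmf of the random variable `f`: `law μ f a = P(f = a)`. -/
noncomputable def law (μ : Ω → ℝ) (f : Ω → A) (a : A) : ℝ :=
  ∑ ω ∈ Finset.univ.filter (fun ω => f ω = a), μ ω

/-- The entropy `H(f) = - ∑ₐ P(f = a) log₂ P(f = a)`, in bits. -/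
noncomputable def entropy (μ : Ω → ℝ) (f : Ω → A) : ℝ :=
  ∑ a, Real.negMulLog (law μ f a) / Real.log 2

/-- The conditional entropy `H(f | g) = H(f, g) - H(g)`. -/
noncomputable def condEntropy (μ : Ω → ℝ) (f : Ω → A) (g : Ω → B) : ℝ :=
  entropy μ (fun ω => (f ω, g ω)) - entropy μ g

/-- The mutual information `I(f; g) = H(f) - H(f | g)`. -/
noncomputable def mutualInfo (μ : Ω → ℝ) (f : Ω → A) (g : Ω → B) : ℝ :=
  entropy μ f - condEntropy μ f g

/-- The conditional mutual information `I(f; g | h) = H(f | h) - H(f | g, h)`. -/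
noncomputable def condMutualInfo (μ : Ω → ℝ) (f : Ω → A) (g : Ω → B) (h : Ω → C) : ℝ :=
  condEntropy μ f h - condEntropy μ f (fun ω => (g ω, h ω))

end Information

/-! ### Channels and codes -/

/-- A discrete memoryless channel `p(y, z | x)` with input alphabet `X`, output alphabet `Y` at the
receiver and output alphabet `Z` at the side receiver: `prob x (y, z) = p(y, z | x)`. -/
structure Channel (X Y Z : Type*) [Fintype Y] [Fintype Z] where
  prob : X → Y × Z → ℝ
  prob_mem : ∀ x, prob x ∈ stdSimplex ℝ (Y × Z)

/-- A code with `M` messages and block length `n`: a (deterministic) encoder and a decoder. -/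
structure Code (X Y : Type*) (M n : ℕ) where
  enc : Fin M → Fin n → X
  dec : (Fin n → Y) → Fin M

/-- The number of messages of a `(2^{nR}, n)` code, rounded up to an integer. -/
noncomputable def numMessages (R : ℝ) (n : ℕ) : ℕ := ⌈(2 : ℝ) ^ ((n : ℝ) * R)⌉₊

section Region

variable {X Y Z : Type*} [Fintype X] [Fintype Y] [Fintype Z]

/-- The joint pmf of the message, uniform on `Fin M`, and of the `n` pairs of channel outputs
`(Yᵢ, Zᵢ)` when the codeword of the message is sent over the memoryless channel `W`. -/
noncomputable def codePmf (W : Channel X Y Z) {M n : ℕ} (c : Code X Y M n) :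
    Fin M × (Fin n → Y × Z) → ℝ :=
  fun ω => (1 / (M : ℝ)) * ∏ i, W.prob (c.enc ω.1 i) (ω.2 i)

open Classical in
/-- The average probability of error `P(M̂ ≠ M)`. -/
noncomputable def errorProb (W : Channel X Y Z) {M n : ℕ} (c : Code X Y M n) : ℝ :=
  ∑ ω ∈ Finset.univ.filter
    (fun ω : Fin M × (Fin n → Y × Z) => c.dec (fun i => (ω.2 i).1) ≠ ω.1), codePmf W c ω

/-- The disturbance rate `(1/n) I(Xⁿ; Zⁿ)`. -/
noncomputable def disturbanceRate (W : Channel X Y Z) {M n : ℕ} (c : Code X Y M n) : ℝ :=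
  (1 / (n : ℝ)) * mutualInfo (codePmf W c) (fun ω => c.enc ω.1) (fun ω i => (ω.2 i).2)

/-- Achievability of the rate-disturbance pair `(R, Rd)`. The upper limit is taken in the extended
reals. -/
def Achievable (W : Channel X Y Z) (R Rd : ℝ) : Prop :=
  0 ≤ R ∧ 0 ≤ Rd ∧ ∃ c : ∀ n : ℕ, Code X Y (numMessages R n) n,
    Filter.Tendsto (fun n => errorProb W (c n)) Filter.atTop (nhds 0) ∧
    Filter.limsup (fun n => (disturbanceRate W (c n) : EReal)) Filter.atTop ≤ (Rd : EReal)

/-- The rate-disturbance region: the closure of the set of achievable pairs. -/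
def rateDisturbanceRegion (W : Channel X Y Z) : Set (ℝ × ℝ) :=
  closure {r : ℝ × ℝ | Achievable W r.1 r.2}

/-- The joint pmf `p(u, x) p(y, z | x)` of `(U, X, (Y, Z))`. -/
def jointPmf {U : Type*} (W : Channel X Y Z) (p : U × X → ℝ) : U × X × (Y × Z) → ℝ :=
  fun ω => p (ω.1, ω.2.1) * W.prob ω.2.1 ω.2.2

/-- `I(X; Y)` for `(U, X, Y, Z) ∼ p(u, x) p(y, z | x)`. -/
noncomputable def infoXY {U : Type*} [Fintype U] (W : Channel X Y Z) (p : U × X → ℝ) : ℝ :=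
  mutualInfo (jointPmf W p) (fun ω => ω.2.1) (fun ω => ω.2.2.1)

/-- `I(X; Y | U)` for `(U, X, Y, Z) ∼ p(u, x) p(y, z | x)`. -/
noncomputable def infoXYgivenU {U : Type*} [Fintype U] (W : Channel X Y Z) (p : U × X → ℝ) : ℝ :=
  condMutualInfo (jointPmf W p) (fun ω => ω.2.1) (fun ω => ω.2.2.1) (fun ω => ω.1)

/-- `I(X; Z | U)` for `(U, X, Y, Z) ∼ p(u, x) p(y, z | x)`. -/
noncomputable def infoXZgivenU {U : Type*} [Fintype U] (W : Channel X Y Z) (p : U × X → ℝ) : ℝ :=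
  condMutualInfo (jointPmf W p) (fun ω => ω.2.1) (fun ω => ω.2.2.2) (fun ω => ω.1)

end Region

end DisturbanceChannel

namespace DisturbanceChannel

open Finset

/-! ### Laws of random variables and entropies in nats -/

section Law

variable {Ω A B C : Type*} [Fintype Ω]

/-! Everything is expressed through `chanInfo`, the mutual information in nats of an unnormalized
input vector. It is homogeneous of degree one, so I(X;Y|U) and I(X;Z|U) are sums of `chanInfo` over
the rows p(u,·), with no division by p(u). The basic inequality is Gibbs' (`sum_negMulLog_le`):
Fano's inequality, submodularity, the passage to the average marginal and the disturbance bound all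
come from it by choosing a reference distribution.

Converse. Take U to be a uniform time index i together with the Y-outputs before i and the Z-outputs
after i. The Csiszár–Körner identity (`sum_nent_sideOutputs_sub`) turns I(Xⁿ;Yⁿ) − I(Xⁿ;Zⁿ) into
exactly n(I(X;Y|U) − I(X;Z|U)). Since U contains the future of Z, the chain rule gives nI(X;Z|U) ≤
I(Xⁿ;Zⁿ) (`sum_nent_sideOutputs_le`), and averaging over time gives I(Xⁿ;Yⁿ) ≤ nI(X;Y). Together
with `fano` this proves the three constraints up to ε. A Carathéodory argument (`exists_pmf_fin`)
then makes the alphabet of U independent of n, so that compactness of the simplex removes ε.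

Achievability. Use superposition codes with about 2^{nR₀} cloud centres, R₀ = max(0, R − I(X;Y|U)).
Decoding succeeds if R < I(X;Y) and R − R₀ < I(X;Y|U). Comparing the law of Zⁿ with the uniform
mixture of the output laws of the clouds bounds the disturbance by nR₀ plus a divergence whose mean
is nI(X;Z|U) (`nent_sub_noiseEntropy_le`). The last two constraints of the theorem say precisely
that R₀ + I(X;Z|U) ≤ R_d. One codebook must have small error and small disturbance at once; random
coding is therefore applied to the single cost n²·P(error) + divergence. -/

theorem sum_law_mul [Fintype A] (μ : Ω → ℝ) (f : Ω → A) (F : A → ℝ) :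
    ∑ a, law μ f a * F a = ∑ ω, μ ω * F (f ω) := by
  classical
  rw [← Finset.sum_fiberwise univ f]
  refine sum_congr rfl fun a _ => ?_
  unfold law
  rw [Finset.sum_mul]
  refine Finset.sum_congr (by ext; simp) fun ω h => ?_
  rw [(Finset.mem_filter.1 h).2]

theorem sum_law [Fintype A] (μ : Ω → ℝ) (f : Ω → A) : ∑ a, law μ f a = ∑ ω, μ ω := by
  simpa using sum_law_mul μ f (fun _ => 1)

theorem law_eq_sum_ite [DecidableEq A] (μ : Ω → ℝ) (f : Ω → A) (a : A) :
    law μ f a = ∑ ω, μ ω * if f ω = a then 1 else 0 := by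
  simp only [law, Finset.sum_filter, mul_ite, mul_one, mul_zero]
  congr!

theorem law_nonneg {μ : Ω → ℝ} (hμ : ∀ ω, 0 ≤ μ ω) (f : Ω → A) (a : A) : 0 ≤ law μ f a :=
  Finset.sum_nonneg fun ω _ => hμ ω

theorem law_mem [Fintype A] {μ : Ω → ℝ} (hμ : μ ∈ stdSimplex ℝ Ω) (f : Ω → A) :
    law μ f ∈ stdSimplex ℝ A :=
  ⟨law_nonneg hμ.1 f, by rw [sum_law, hμ.2]⟩

theorem law_law [Fintype A] (μ : Ω → ℝ) (f : Ω → A) (g : A → B) :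
    law (law μ f) g = law μ (fun ω => g (f ω)) := by
  classical
  ext b
  rw [law_eq_sum_ite, sum_law_mul μ f (fun a => if g a = b then 1 else 0), law_eq_sum_ite]

theorem le_law_self {μ : Ω → ℝ} (hμ : ∀ ω, 0 ≤ μ ω) (f : Ω → A) (ω : Ω) :
    μ ω ≤ law μ f (f ω) := by
  classical
  exact Finset.single_le_sum (f := μ) (fun ω _ => hμ ω) (by simp)

/-- The entropy of a random variable in nats. -/
noncomputable def nent [Fintype A] (μ : Ω → ℝ) (f : Ω → A) : ℝ := ∑ a, Real.negMulLog (law μ f a)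

theorem entropy_eq_nent [Fintype A] (μ : Ω → ℝ) (f : Ω → A) : entropy μ f = nent μ f / Real.log 2 := by
  simp only [entropy, nent, Finset.sum_div]

theorem nent_eq_neg_sum [Fintype A] (μ : Ω → ℝ) (f : Ω → A) :
    nent μ f = -∑ ω, μ ω * Real.log (law μ f (f ω)) := by
  rw [← sum_law_mul μ f (fun a => Real.log (law μ f a)), ← Finset.sum_neg_distrib]
  exact Finset.sum_congr rfl fun a _ => by rw [Real.negMulLog]; ring

/-- Random variables that determine each other have the same entropy. -/
theorem nent_congr [Fintype A] [Fintype B] (μ : Ω → ℝ) {f : Ω → A} {g : Ω → B}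
    (h : ∀ ω ω', f ω = f ω' ↔ g ω = g ω') : nent μ f = nent μ g := by
  classical
  rw [nent_eq_neg_sum, nent_eq_neg_sum]
  simp only [law_eq_sum_ite]
  congr! 7
  exact h _ _

theorem nent_const [Fintype A] {μ : Ω → ℝ} (hμ : ∑ ω, μ ω = 1) {f : Ω → A} (h : ∀ ω ω', f ω = f ω') :
    nent μ f = 0 := by
  rw [nent_eq_neg_sum]
  have : ∀ ω, law μ f (f ω) = 1 := fun ω => by
    classical
    rw [← hμ, law_eq_sum_ite]
    simp [fun ω' => h ω' ω]
  simp [this]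

/-- Gibbs' inequality. -/
theorem sum_negMulLog_le [Fintype A] {p q : A → ℝ} (hp : ∀ a, 0 ≤ p a) (hq : ∀ a, 0 ≤ q a)
    (hpq : ∀ a, q a = 0 → p a = 0) (hs : ∑ a, q a ≤ ∑ a, p a) :
    ∑ a, Real.negMulLog (p a) ≤ -∑ a, p a * Real.log (q a) := by
  -- Termwise this is log t ≤ t − 1 at t = q a / p a.
  have key : ∀ a, Real.negMulLog (p a) + p a * Real.log (q a) ≤ q a - p a := by
    intro a
    rcases (hp a).eq_or_lt with h | h
    · simp [← h, hq a]
    · have hq' : 0 < q a := (hq a).lt_of_ne fun h0 => h.ne' (hpq a h0.symm)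
      have := Real.log_le_sub_one_of_pos (div_pos hq' h)
      rw [Real.log_div hq'.ne' h.ne'] at this
      have h2 := mul_le_mul_of_nonneg_left this h.le
      rw [mul_sub (p a) (q a / p a), mul_div_cancel₀ _ h.ne'] at h2
      rw [Real.negMulLog]
      linarith
  have h := Finset.sum_le_sum fun a (_ : a ∈ univ) => key a
  rw [Finset.sum_add_distrib, Finset.sum_sub_distrib] at h
  linarith

/-- Submodularity of entropy: conditioning on `g` in addition to `h` reduces the entropy of `f`. -/
theorem nent_submodular [Fintype A] [Fintype B] [Fintype C] {μ : Ω → ℝ} (hμ : ∀ ω, 0 ≤ μ ω) (f : Ω → A) (g : Ω → B) (h : Ω → C) :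
    nent μ (fun ω => (f ω, g ω, h ω)) + nent μ h ≤
      nent μ (fun ω => (f ω, h ω)) + nent μ (fun ω => (g ω, h ω)) := by
  set T : Ω → A × B × C := fun ω => (f ω, g ω, h ω)
  set pac := law μ (fun ω => (f ω, h ω))
  set pbc := law μ (fun ω => (g ω, h ω))
  set pc := law μ h
  have hc1 : ∀ c, ∑ a, pac (a, c) = pc c := by
    intro c
    classical
    have : pc = law pac (fun x => x.2) := by rw [law_law]
    rw [this, law_eq_sum_ite, Fintype.sum_prod_type]
    simp
  have hc2 : ∀ c, ∑ b, pbc (b, c) = pc c := by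
    intro c
    classical
    have : pc = law pbc (fun x => x.2) := by rw [law_law]
    rw [this, law_eq_sum_ite, Fintype.sum_prod_type]
    simp
  -- The reference distribution for Gibbs is p(a,c)p(b,c)/p(c), which makes f and g conditionally
  -- independent given h. Where p(c) = 0 the convention 0/0 = 0 gives the right mass.
  have hs : ∑ x : A × B × C, pac (x.1, x.2.2) * pbc (x.2.1, x.2.2) / pc x.2.2
      = ∑ x, law μ T x := by
    rw [sum_law, ← sum_law μ h]
    simp only [Fintype.sum_prod_type]
    rw [Finset.sum_congr rfl fun a _ => Finset.sum_comm, Finset.sum_comm]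
    refine Finset.sum_congr rfl fun c _ => ?_
    simp only [mul_div_assoc, ← Finset.mul_sum, ← Finset.sum_div, hc2]
    rw [← Finset.sum_mul, hc1]
    by_cases h0 : pc c = 0
    · simp only [h0, mul_zero, div_zero]; exact h0.symm
    · rw [div_self h0, mul_one]
  have n1 : ∀ x, 0 ≤ pac x := law_nonneg hμ _
  have n2 : ∀ x, 0 ≤ pbc x := law_nonneg hμ _
  have n3 : ∀ x, 0 ≤ pc x := law_nonneg hμ _
  have pos : ∀ x, law μ T x ≠ 0 → 0 < pac (x.1, x.2.2) ∧ 0 < pbc (x.2.1, x.2.2) ∧ 0 < pc x.2.2 := by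
    intro x hx
    obtain ⟨ω, hω, h0⟩ := Finset.exists_ne_zero_of_sum_ne_zero hx
    have hω : T ω = x := by simpa using hω
    have hpos : 0 < μ ω := (hμ ω).lt_of_ne' h0
    subst hω
    exact ⟨hpos.trans_le (le_law_self hμ (fun ω => (f ω, h ω)) ω),
      hpos.trans_le (le_law_self hμ (fun ω => (g ω, h ω)) ω), hpos.trans_le (le_law_self hμ h ω)⟩
  have G := sum_negMulLog_le (p := law μ T)
    (q := fun x => pac (x.1, x.2.2) * pbc (x.2.1, x.2.2) / pc x.2.2) (law_nonneg hμ T)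
    (fun x => div_nonneg (mul_nonneg (n1 _) (n2 _)) (n3 _))
    (fun x hx => by
      by_contra h0
      obtain ⟨h1, h2, h3⟩ := pos x h0
      exact (div_pos (mul_pos h1 h2) h3).ne' hx) hs.le
  have e : ∀ x, law μ T x * Real.log (pac (x.1, x.2.2) * pbc (x.2.1, x.2.2) / pc x.2.2)
      = law μ T x * (Real.log (pac (x.1, x.2.2)) + Real.log (pbc (x.2.1, x.2.2))
        - Real.log (pc x.2.2)) := by
    intro x
    by_cases h0 : law μ T x = 0
    · simp [h0]
    · obtain ⟨h1, h2, h3⟩ := pos x h0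
      rw [Real.log_div (mul_pos h1 h2).ne' h3.ne', Real.log_mul h1.ne' h2.ne']
  rw [Finset.sum_congr rfl fun x _ => e x, sum_law_mul μ T (fun x =>
    Real.log (pac (x.1, x.2.2)) + Real.log (pbc (x.2.1, x.2.2)) - Real.log (pc x.2.2))] at G
  simp only [mul_sub, mul_add, Finset.sum_sub_distrib, Finset.sum_add_distrib] at G
  rw [nent_eq_neg_sum μ h, nent_eq_neg_sum μ (fun ω => (f ω, h ω)),
    nent_eq_neg_sum μ (fun ω => (g ω, h ω))]
  change nent μ T ≤ _ at G
  simp only [T, pac, pbc, pc] at G ⊢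
  linarith

/-- The chain rule for a random variable followed by a channel. -/
theorem nent_prod_of_kernel [Fintype A] [Fintype B] {μ : Ω → ℝ} {f : Ω → A} {g : Ω → B} {K : A → B → ℝ}
    (hK : ∀ a, ∑ b, K a b = 1)
    (h : ∀ a b, law μ (fun ω => (f ω, g ω)) (a, b) = law μ f a * K a b) :
    nent μ (fun ω => (f ω, g ω)) =
      nent μ f + ∑ a, law μ f a * ∑ b, Real.negMulLog (K a b) := by
  rw [nent, nent, Fintype.sum_prod_type, ← Finset.sum_add_distrib]
  refine Finset.sum_congr rfl fun a _ => ?_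
  simp only [h, Real.negMulLog_mul, Finset.sum_add_distrib, ← Finset.sum_mul, ← Finset.mul_sum, hK,
    one_mul]

end Law

/-! ### Product distributions -/

section Product

variable {ι B C : Type*} [Fintype ι] [DecidableEq ι] [Fintype B]

theorem sum_pi_prod (K : ι → B → ℝ) : ∑ b : ι → B, ∏ i, K i (b i) = ∏ i, ∑ c, K i c := by
  rw [Finset.prod_univ_sum, Fintype.piFinset_univ]

theorem sum_pi_prod_eq_one {K : ι → B → ℝ} (hK : ∀ i, ∑ c, K i c = 1) :
    ∑ b : ι → B, ∏ i, K i (b i) = 1 := by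
  rw [sum_pi_prod]; simp [hK]

theorem pi_prod_mem {K : ι → B → ℝ} (hK : ∀ i, K i ∈ stdSimplex ℝ B) :
    (fun b : ι → B => ∏ i, K i (b i)) ∈ stdSimplex ℝ (ι → B) :=
  ⟨fun _ => Finset.prod_nonneg fun i _ => (hK i).1 _, sum_pi_prod_eq_one fun i => (hK i).2⟩

/-- Resampling one coordinate does not change the expectation under a product distribution. -/
theorem sum_pi_resample (K : ι → B → ℝ) (i : ι) (hK : ∑ c, K i c = 1) (F : (ι → B) → ℝ) :
    ∑ b : ι → B, (∏ j, K j (b j)) * F b =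
      ∑ b : ι → B, (∏ j, K j (b j)) * ∑ c, K i c * F (Function.update b i c) := by
  rw [← (Equiv.funSplitAt i B).symm.sum_comp, ← (Equiv.funSplitAt i B).symm.sum_comp,
    Fintype.sum_prod_type_right, Fintype.sum_prod_type_right]
  refine Finset.sum_congr rfl fun r _ => ?_
  have hprod : ∀ c, ∏ j, K j ((Equiv.funSplitAt i B).symm (c, r) j) =
      K i c * ∏ j : {j // j ≠ i}, K j (r j) := by
    intro c
    rw [Fintype.prod_eq_mul_prod_subtype_ne _ i]
    congr 1
    · simp [Equiv.funSplitAt]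
    · exact Finset.prod_congr rfl fun j _ => by simp [Equiv.funSplitAt, j.2]
  have hupd : ∀ c c', Function.update ((Equiv.funSplitAt i B).symm (c, r)) i c' =
      (Equiv.funSplitAt i B).symm (c', r) := by
    intro c c'
    ext j
    by_cases hj : j = i
    · subst hj; simp [Equiv.funSplitAt]
    · simp [Equiv.funSplitAt, hj]
  simp only [hprod, hupd]
  rw [← Finset.sum_mul, ← Finset.sum_mul, hK, one_mul, Finset.mul_sum]
  exact Finset.sum_congr rfl fun c _ => by ring

theorem sum_pi_apply {K : ι → B → ℝ} (hK : ∀ i, ∑ c, K i c = 1) (i : ι) (F : B → ℝ) :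
    ∑ b : ι → B, (∏ j, K j (b j)) * F (b i) = ∑ c, K i c * F c := by
  rw [sum_pi_resample K i (hK i)]
  simp only [Function.update_self]
  rw [← Finset.sum_mul, sum_pi_prod_eq_one hK, one_mul]

theorem sum_pi_apply_apply {K : ι → B → ℝ} (hK : ∀ i, ∑ c, K i c = 1) {i j : ι} (hij : i ≠ j)
    (F : B → B → ℝ) :
    ∑ b : ι → B, (∏ l, K l (b l)) * F (b i) (b j) = ∑ c, K i c * ∑ d, K j d * F c d := by
  rw [sum_pi_resample K i (hK i)]
  simp only [Function.update_self, Function.update_of_ne hij.symm]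
  rw [sum_pi_apply hK j (fun d => ∑ c, K i c * F c d)]
  simp only [Finset.mul_sum]
  rw [Finset.sum_comm]
  exact Finset.sum_congr rfl fun c _ => Finset.sum_congr rfl fun d _ => by ring

/-- The law of a coordinatewise function under a product distribution. -/
theorem law_pi (K : ι → B → ℝ) (g : ι → B → C) (c : ι → C) :
    law (fun b : ι → B => ∏ i, K i (b i)) (fun b i => g i (b i)) c =
      ∏ i, law (K i) (g i) (c i) := by
  classical
  simp only [law_eq_sum_ite]
  rw [← sum_pi_prod (fun i b => K i b * if g i b = c i then 1 else 0)]
  refine Finset.sum_congr rfl fun b _ => ?_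
  rw [Finset.prod_mul_distrib, Finset.prod_ite_zero]
  simp [funext_iff]

/-- The entropy of a product distribution. -/
theorem sum_negMulLog_pi {K : ι → B → ℝ} (hK : ∀ i, ∑ c, K i c = 1) :
    ∑ b : ι → B, Real.negMulLog (∏ i, K i (b i)) = ∑ i, ∑ c, Real.negMulLog (K i c) := by
  have h : ∀ b : ι → B, Real.negMulLog (∏ i, K i (b i)) =
      ∑ i, (∏ j, K j (b j)) * -Real.log (K i (b i)) := by
    intro b
    by_cases h0 : ∏ i, K i (b i) = 0
    · simp [h0]
    · rw [Real.negMulLog, Real.log_prod fun i hi => (Finset.prod_ne_zero_iff.1 h0) i hi,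
        ← Finset.mul_sum, Finset.sum_neg_distrib]
      ring
  rw [Finset.sum_congr rfl fun b _ => h b, Finset.sum_comm]
  refine Finset.sum_congr rfl fun i _ => ?_
  rw [sum_pi_apply hK i (fun c => -Real.log (K i c))]
  exact Finset.sum_congr rfl fun c _ => by rw [Real.negMulLog]; ring

end Product

/-! ### Single-letter information as a function of the input distribution -/

section ChanInfo

variable {X Y Z B U : Type*} [Fintype Y] [Fintype Z] [Fintype B]

/-- The mutual information in nats between the input and the output of the channel `K` with
unnormalized input distribution `q`; it is homogeneous of degree one in `q`. -/
noncomputable def chanInfo [Fintype X] (K : X → B → ℝ) (q : X → ℝ) : ℝ :=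
  ∑ b, Real.negMulLog (∑ x, q x * K x b) - Real.negMulLog (∑ x, q x) -
    ∑ x, q x * ∑ b, Real.negMulLog (K x b)

theorem continuous_chanInfo [Fintype X] (K : X → B → ℝ) : Continuous (chanInfo K) := by
  unfold chanInfo
  refine ((continuous_finsetSum _ fun b _ => Real.continuous_negMulLog.comp ?_).sub
    (Real.continuous_negMulLog.comp ?_)).sub ?_ <;> fun_prop

/-- The terms with log t cancel because the channel preserves total mass: outputs and inputs
contribute the same multiple of log t with opposite signs. -/
theorem chanInfo_smul [Fintype X] {K : X → B → ℝ} (hK : ∀ x, ∑ b, K x b = 1) (t : ℝ) (q : X → ℝ) :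
    chanInfo K (fun x => t * q x) = t * chanInfo K q := by
  have h2 : ∑ b, ∑ x, q x * K x b = ∑ x, q x := by
    rw [Finset.sum_comm]; simp only [← Finset.mul_sum, hK, mul_one]
  simp only [chanInfo, ← Finset.mul_sum, Real.negMulLog_mul, Finset.sum_add_distrib,
    ← Finset.sum_mul, h2, mul_assoc]
  ring

theorem chanInfo_eq_of_sum_eq_one [Fintype X] {K : X → B → ℝ} {q : X → ℝ} (hq : ∑ x, q x = 1) :
    chanInfo K q = ∑ b, Real.negMulLog (∑ x, q x * K x b) -
      ∑ x, q x * ∑ b, Real.negMulLog (K x b) := by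
  rw [chanInfo, hq, Real.negMulLog_one, sub_zero]

/-- The marginal channel `p(y | x)`. -/
noncomputable def Channel.toY (W : Channel X Y Z) (x : X) : Y → ℝ := law (W.prob x) Prod.fst

/-- The marginal channel `p(z | x)`. -/
noncomputable def Channel.toZ (W : Channel X Y Z) (x : X) : Z → ℝ := law (W.prob x) Prod.snd

theorem Channel.toY_mem (W : Channel X Y Z) (x : X) : W.toY x ∈ stdSimplex ℝ Y :=
  law_mem (W.prob_mem x) _

theorem Channel.toZ_mem (W : Channel X Y Z) (x : X) : W.toZ x ∈ stdSimplex ℝ Z :=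
  law_mem (W.prob_mem x) _

variable [Fintype X] [Fintype U]

theorem sum_jointPmf_mul (W : Channel X Y Z) (p : U × X → ℝ) (π : Y × Z → B)
    (F : U → X → B → ℝ) :
    ∑ ω, jointPmf W p ω * F ω.1 ω.2.1 (π ω.2.2) =
      ∑ u, ∑ x, p (u, x) * ∑ b, law (W.prob x) π b * F u x b := by
  simp only [Fintype.sum_prod_type (α₁ := U), Fintype.sum_prod_type (α₁ := X)]
  refine Finset.sum_congr rfl fun u _ => Finset.sum_congr rfl fun x _ => ?_
  rw [sum_law_mul, Finset.mul_sum]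
  exact Finset.sum_congr rfl fun yz _ => by rw [jointPmf]; ring

theorem law_jointPmf_prod (W : Channel X Y Z) (p : U × X → ℝ) (π : Y × Z → B) (u : U) (b : B) :
    law (jointPmf W p) (fun ω => (π ω.2.2, ω.1)) (b, u) =
      ∑ x, p (u, x) * law (W.prob x) π b := by
  classical
  rw [law_eq_sum_ite, sum_jointPmf_mul W p π (fun u' x b' => if (b', u') = (b, u) then 1 else 0)]
  simp [Prod.ext_iff, ite_and]

theorem law_jointPmf_snd (W : Channel X Y Z) (p : U × X → ℝ) (π : Y × Z → B) (b : B) :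
    law (jointPmf W p) (fun ω => π ω.2.2) b =
      ∑ x, (∑ u, p (u, x)) * law (W.prob x) π b := by
  classical
  rw [law_eq_sum_ite, sum_jointPmf_mul W p π (fun u' x b' => if b' = b then 1 else 0),
    Finset.sum_comm]
  simp [Finset.sum_mul]

theorem law_jointPmf_fst (W : Channel X Y Z) (p : U × X → ℝ) (u : U) :
    law (jointPmf W p) (fun ω => ω.1) u = ∑ x, p (u, x) := by
  classical
  rw [law_eq_sum_ite,
    sum_jointPmf_mul W p id (fun u' x b' => if u' = u then 1 else 0)]
  simp [sum_law, (W.prob_mem _).2]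

theorem nent_jointPmf_triple (W : Channel X Y Z) (p : U × X → ℝ) (π : Y × Z → B) :
    nent (jointPmf W p) (fun ω => ((ω.2.1, ω.1), π ω.2.2)) =
      nent (jointPmf W p) (fun ω => (ω.2.1, ω.1)) +
        ∑ u, ∑ x, p (u, x) * ∑ b, Real.negMulLog (law (W.prob x) π b) := by
  have hone : ∀ x, ∑ b, law (W.prob x) π b = 1 := fun x => by rw [sum_law, (W.prob_mem x).2]
  have hl : ∀ x u, law (jointPmf W p) (fun ω => (ω.2.1, ω.1)) (x, u) = p (u, x) := by
    intro x u
    classical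
    rw [law_eq_sum_ite,
      sum_jointPmf_mul W p π (fun u' x' b' => if (x', u') = (x, u) then 1 else 0)]
    simp [Prod.ext_iff, ite_and, hone]
  rw [nent_prod_of_kernel (K := fun a => law (W.prob a.1) π) (fun a => hone a.1)]
  · rw [Fintype.sum_prod_type_right]
    simp only [hl]
  · rintro ⟨x, u⟩ b
    classical
    rw [hl, law_eq_sum_ite, sum_jointPmf_mul W p π
      (fun u' x' b' => if ((x', u'), b') = ((x, u), b) then 1 else 0)]
    simp [Prod.ext_iff, ite_and]

/-- By the chain rule the entropy of (X,U) cancels. What remains is H(Y,U) − H(U) minus the noise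
entropy, and each of these is a sum over u. -/
theorem condMutualInfo_jointPmf (W : Channel X Y Z) (p : U × X → ℝ) (π : Y × Z → B) :
    condMutualInfo (jointPmf W p) (fun ω => ω.2.1) (fun ω => π ω.2.2) (fun ω => ω.1) =
      (∑ u, chanInfo (fun x => law (W.prob x) π) (fun x => p (u, x))) / Real.log 2 := by
  have h := nent_jointPmf_triple W p π
  rw [nent_congr (g := fun ω : U × X × Y × Z => (ω.2.1, π ω.2.2, ω.1)) _
    (by intro ω ω'; simp only [Prod.mk.injEq]; tauto)] at h
  have h1 : nent (jointPmf W p) (fun ω => (π ω.2.2, ω.1)) =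
      ∑ u, ∑ b, Real.negMulLog (∑ x, p (u, x) * law (W.prob x) π b) := by
    simp only [nent, Fintype.sum_prod_type_right, law_jointPmf_prod]
  have h2 : nent (jointPmf W p) (fun ω => ω.1) = ∑ u, Real.negMulLog (∑ x, p (u, x)) := by
    simp only [nent, law_jointPmf_fst]
  simp only [condMutualInfo, condEntropy, entropy_eq_nent, h, h1, h2, chanInfo,
    Finset.sum_sub_distrib]
  ring

theorem mutualInfo_jointPmf (W : Channel X Y Z) {p : U × X → ℝ} (hp : ∑ a, p a = 1)
    (π : Y × Z → B) :
    mutualInfo (jointPmf W p) (fun ω => ω.2.1) (fun ω => π ω.2.2) =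
      chanInfo (fun x => law (W.prob x) π) (fun x => ∑ u, p (u, x)) / Real.log 2 := by
  have hone : ∀ x, ∑ b, law (W.prob x) π b = 1 := fun x => by rw [sum_law, (W.prob_mem x).2]
  have hl : ∀ x, law (jointPmf W p) (fun ω => ω.2.1) x = ∑ u, p (u, x) := by
    intro x
    classical
    rw [law_eq_sum_ite, sum_jointPmf_mul W p π (fun u' x' b' => if x' = x then 1 else 0)]
    simp [hone]
  have h := nent_prod_of_kernel (μ := jointPmf W p) (f := fun ω => ω.2.1)
    (g := fun ω => π ω.2.2) (K := fun x => law (W.prob x) π) hone (by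
      intro x b
      classical
      rw [hl, law_eq_sum_ite, sum_jointPmf_mul W p π
        (fun u' x' b' => if (x', b') = (x, b) then 1 else 0)]
      simp [Prod.ext_iff, ite_and, Finset.sum_mul])
  have h1 : ∑ x, ∑ u, p (u, x) = 1 := by rw [← hp, Fintype.sum_prod_type_right]
  rw [chanInfo_eq_of_sum_eq_one h1]
  simp only [mutualInfo, condEntropy, entropy_eq_nent, h]
  simp only [hl, nent, law_jointPmf_snd]
  ring

theorem infoXY_eq (W : Channel X Y Z) {p : U × X → ℝ} (hp : ∑ a, p a = 1) :
    infoXY W p = chanInfo W.toY (fun x => ∑ u, p (u, x)) / Real.log 2 :=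
  mutualInfo_jointPmf W hp Prod.fst

theorem infoXYgivenU_eq (W : Channel X Y Z) (p : U × X → ℝ) :
    infoXYgivenU W p = (∑ u, chanInfo W.toY (fun x => p (u, x))) / Real.log 2 :=
  condMutualInfo_jointPmf W p Prod.fst

theorem infoXZgivenU_eq (W : Channel X Y Z) (p : U × X → ℝ) :
    infoXZgivenU W p = (∑ u, chanInfo W.toZ (fun x => p (u, x))) / Real.log 2 :=
  condMutualInfo_jointPmf W p Prod.snd

end ChanInfo

/-! ### Entropies of the message and the channel outputs of a code -/

section CodeLaw

variable {X Y Z A B C : Type*} [Fintype Y] [Fintype Z]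
  {M n : ℕ}

/-- The map π is a projection to Y or to Z (or the identity), so one computation serves both
receivers. -/
theorem sum_codePmf_mul [Fintype B] (W : Channel X Y Z) (c : Code X Y M n) (π : Y × Z → B)
    (F : Fin M → (Fin n → B) → ℝ) :
    ∑ ω, codePmf W c ω * F ω.1 (fun i => π (ω.2 i)) =
      1 / (M : ℝ) * ∑ m, ∑ b : Fin n → B, (∏ i, law (W.prob (c.enc m i)) π (b i)) * F m b := by
  rw [Fintype.sum_prod_type, Finset.mul_sum]
  refine Finset.sum_congr rfl fun m _ => ?_
  have h := sum_law_mul (fun w : Fin n → Y × Z => ∏ i, W.prob (c.enc m i) (w i))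
    (fun w i => π (w i)) (F m)
  simp only [law_pi (fun i => W.prob (c.enc m i)) (fun _ => π)] at h
  rw [h, Finset.mul_sum]
  exact Finset.sum_congr rfl fun w _ => by simp only [codePmf]; ring

theorem codePmf_mem (W : Channel X Y Z) (c : Code X Y M n) (hM : 0 < M) :
    codePmf W c ∈ stdSimplex ℝ (Fin M × (Fin n → Y × Z)) := by
  refine ⟨fun ω => mul_nonneg (by positivity) (Finset.prod_nonneg fun i _ => (W.prob_mem _).1 _), ?_⟩
  have h := sum_codePmf_mul W c id (fun _ _ => 1)
  have hM' : (M : ℝ) ≠ 0 := by positivity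
  simp only [mul_one] at h
  rw [h]
  have h1 : ∀ m, ∑ b : Fin n → Y × Z, ∏ i, law (W.prob (c.enc m i)) id (b i) = 1 := fun m =>
    sum_pi_prod_eq_one fun i => by rw [sum_law, (W.prob_mem _).2]
  simp [h1, hM']

/-- The average over the messages of the conditional output entropy (in nats) of a code over the
channel `K`. -/
noncomputable def noiseEntropy [Fintype B] (K : X → B → ℝ) (enc : Fin M → Fin n → X) : ℝ :=
  1 / (M : ℝ) * ∑ m, ∑ i, ∑ b, Real.negMulLog (K (enc m i) b)

/-- The variable e only has to determine the codeword, through κ. It is the message itself in `fano`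
and the codeword in `mutualInfo_codePmf`. -/
theorem nent_input_output [Fintype A] [Fintype B] (W : Channel X Y Z) (c : Code X Y M n) (π : Y × Z → B)
    (e : Fin M → A) (κ : A → Fin n → X) (he : ∀ m, κ (e m) = c.enc m) :
    nent (codePmf W c) (fun ω => (e ω.1, fun i => π (ω.2 i))) =
      nent (codePmf W c) (fun ω => e ω.1) +
        noiseEntropy (fun x => law (W.prob x) π) c.enc := by
  classical
  have hone : ∀ x, ∑ b, law (W.prob x) π b = 1 := fun x => by rw [sum_law, (W.prob_mem x).2]
  have hprod : ∀ x : Fin n → X, ∑ b : Fin n → B, ∏ i, law (W.prob (x i)) π (b i) = 1 := fun x =>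
    sum_pi_prod_eq_one fun i => hone (x i)
  rw [nent_prod_of_kernel (f := fun ω : Fin M × (Fin n → Y × Z) => e ω.1)
    (g := fun ω i => π (ω.2 i)) (K := fun a b => ∏ i, law (W.prob (κ a i)) π (b i))
    (fun a => hprod (κ a))]
  · congr 1
    rw [sum_law_mul _ (fun ω : Fin M × (Fin n → Y × Z) => e ω.1)
      (fun a => ∑ b : Fin n → B, Real.negMulLog (∏ i, law (W.prob (κ a i)) π (b i)))]
    rw [sum_codePmf_mul W c π
      (fun m _ => ∑ b : Fin n → B, Real.negMulLog (∏ i, law (W.prob (κ (e m) i)) π (b i)))]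
    simp only [← Finset.sum_mul, he]
    rw [noiseEntropy]
    congr 1
    refine Finset.sum_congr rfl fun m _ => ?_
    rw [hprod, one_mul, sum_negMulLog_pi fun i => hone (c.enc m i)]
  · intro a b
    rw [law_eq_sum_ite, law_eq_sum_ite,
      sum_codePmf_mul W c π (fun m b' => if (e m, b') = (a, b) then 1 else 0),
      sum_codePmf_mul W c π (fun m b' => if e m = a then 1 else 0), mul_assoc, Finset.sum_mul]
    congr 1
    refine Finset.sum_congr rfl fun m _ => ?_
    rw [← Finset.sum_mul, hprod]
    by_cases h : e m = a
    · subst h; simp [he]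
    · simp [h]

theorem mutualInfo_codePmf [Fintype X] [Fintype B] (W : Channel X Y Z) (c : Code X Y M n) (π : Y × Z → B) :
    mutualInfo (codePmf W c) (fun ω => c.enc ω.1) (fun ω i => π (ω.2 i)) =
      (nent (codePmf W c) (fun ω i => π (ω.2 i)) -
        noiseEntropy (fun x => law (W.prob x) π) c.enc) / Real.log 2 := by
  rw [mutualInfo, condEntropy, entropy_eq_nent, entropy_eq_nent, entropy_eq_nent,
    nent_input_output W c π c.enc id (fun _ => rfl)]
  ring

theorem nent_message (W : Channel X Y Z) (c : Code X Y M n) :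
    nent (codePmf W c) (fun ω => ω.1) = Real.log M := by
  rcases Nat.eq_zero_or_pos M with rfl | hM
  · simp [nent]
  have hM' : (M : ℝ) ≠ 0 := by positivity
  have : ∀ m, law (codePmf W c) (fun ω => ω.1) m = 1 / (M : ℝ) := by
    intro m
    rw [law_eq_sum_ite, sum_codePmf_mul W c id (fun m' _ => if m' = m then 1 else 0)]
    have h1 : ∀ m, ∑ b : Fin n → Y × Z, ∏ i, law (W.prob (c.enc m i)) id (b i) = 1 := fun m =>
      sum_pi_prod_eq_one fun i => by rw [sum_law, (W.prob_mem _).2]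
    simp only [← Finset.sum_mul, h1]
    simp
  simp [nent, this, Real.negMulLog]
  field_simp

theorem errorProb_eq (W : Channel X Y Z) (c : Code X Y M n) [DecidableEq (Fin M)] :
    errorProb W c = ∑ ω, codePmf W c ω * if c.dec (fun i => (ω.2 i).1) ≠ ω.1 then 1 else 0 := by
  simp only [errorProb, Finset.sum_filter, mul_ite, mul_one, mul_zero]
  congr!

theorem errorProb_nonneg (W : Channel X Y Z) (c : Code X Y M n) : 0 ≤ errorProb W c :=
  Finset.sum_nonneg fun ω _ =>
    mul_nonneg (by positivity) (Finset.prod_nonneg fun i _ => (W.prob_mem _).1 _)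

/-- Fano's inequality. -/
theorem fano (W : Channel X Y Z) (c : Code X Y M n) (hM : 0 < M) :
    (1 - errorProb W c) * Real.log M - Real.log 2 ≤
      nent (codePmf W c) (fun ω i => (ω.2 i).1) - noiseEntropy W.toY c.enc := by
  classical
  set μ := codePmf W c
  have hμ : μ ∈ stdSimplex ℝ _ := codePmf_mem W c hM
  set f : Fin M × (Fin n → Y × Z) → Fin M × (Fin n → Y) := fun ω => (ω.1, fun i => (ω.2 i).1)
  set g : Fin M × (Fin n → Y × Z) → (Fin n → Y) := fun ω i => (ω.2 i).1
  have h1 : nent μ f = Real.log M + noiseEntropy W.toY c.enc := by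
    rw [← nent_message W c]
    exact nent_input_output W c Prod.fst id c.enc (fun _ => rfl)
  have hM' : (0 : ℝ) < M := by positivity
  have hM1 : (1 : ℝ) ≤ M := by exact_mod_cast hM
  -- Reference distribution for Gibbs: given y, half of the mass sits on the decoded message and
  -- half is uniform. The logarithmic loss is then at most log 2 on correct decoding, and log 2 +
  -- log M otherwise.
  have hkpos : ∀ x : Fin M × (Fin n → Y),
      0 < (1 / 2 : ℝ) * (if c.dec x.2 = x.1 then 1 else 0) + 1 / 2 * (1 / M) := fun x => by
    positivity
  have hle : ∀ x, law μ f x ≤ law μ g x.2 := by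
    intro x
    rw [law_eq_sum_ite, law_eq_sum_ite]
    refine Finset.sum_le_sum fun ω _ => mul_le_mul_of_nonneg_left ?_ (hμ.1 ω)
    by_cases h : f ω = x
    · have : g ω = x.2 := by rw [← h]
      simp [h, this]
    · rw [if_neg h]; split_ifs <;> norm_num
  have G := sum_negMulLog_le (p := law μ f)
    (q := fun x => law μ g x.2 *
      ((1 / 2 : ℝ) * (if c.dec x.2 = x.1 then 1 else 0) + 1 / 2 * (1 / M)))
    (law_nonneg hμ.1 f) (fun x => mul_nonneg (law_nonneg hμ.1 g _) (hkpos x).le)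
    (fun x hx => le_antisymm ((hle x).trans
      ((mul_eq_zero.1 hx).resolve_right (hkpos x).ne').le) (law_nonneg hμ.1 f x))
    (by
      rw [sum_law, hμ.2, Fintype.sum_prod_type_right]
      simp only [← Finset.mul_sum, Finset.sum_add_distrib]
      simp only [Finset.sum_ite_eq, Finset.mem_univ, if_true, Finset.sum_const, Finset.card_univ,
        Fintype.card_fin, nsmul_eq_mul]
      have : (1 / 2 * 1 + (M : ℝ) * (1 / 2 * (1 / M))) = 1 := by field_simp; norm_num
      rw [← Finset.sum_mul, sum_law, hμ.2]
      simp only [one_mul]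
      linarith)
  change nent μ f ≤ _ at G
  rw [sum_law_mul μ f (fun x => Real.log (law μ g x.2 *
      ((1 / 2 : ℝ) * (if c.dec x.2 = x.1 then 1 else 0) + 1 / 2 * (1 / M))))] at G
  have key : -∑ ω, μ ω * Real.log (law μ g (f ω).2 *
      ((1 / 2 : ℝ) * (if c.dec (f ω).2 = (f ω).1 then 1 else 0) + 1 / 2 * (1 / M))) ≤
      -(∑ ω, μ ω * Real.log (law μ g (g ω))) + Real.log 2 * (∑ ω, μ ω) +
        (∑ ω, μ ω * if c.dec (fun i => (ω.2 i).1) ≠ ω.1 then 1 else 0) * Real.log M := by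
    rw [← Finset.sum_neg_distrib, ← Finset.sum_neg_distrib, Finset.mul_sum, Finset.sum_mul,
      ← Finset.sum_add_distrib, ← Finset.sum_add_distrib]
    refine Finset.sum_le_sum fun ω _ => ?_
    rcases (hμ.1 ω).eq_or_lt with h0 | h0
    · simp [μ, ← h0]
    have hg : 0 < law μ g (g ω) := h0.trans_le (le_law_self hμ.1 g ω)
    have e1 : (f ω).2 = g ω := rfl
    have hk := hkpos (f ω)
    rw [e1] at hk ⊢
    rw [Real.log_mul hg.ne' hk.ne']
    have : -Real.log ((1 / 2 : ℝ) * (if c.dec (g ω) = (f ω).1 then 1 else 0) + 1 / 2 * (1 / M)) ≤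
        Real.log 2 + (if c.dec (fun i => (ω.2 i).1) ≠ ω.1 then 1 else 0) * Real.log M := by
      change -Real.log ((1 / 2 : ℝ) * (if c.dec (g ω) = ω.1 then 1 else 0) + 1 / 2 * (1 / M)) ≤
        Real.log 2 + (if c.dec (g ω) ≠ ω.1 then 1 else 0) * Real.log M
      by_cases h : c.dec (g ω) = ω.1
      · simp only [h, if_true, ne_eq, not_true_eq_false, if_false, zero_mul, add_zero, mul_one]
        have : Real.log (1 / 2) ≤ Real.log (1 / 2 + 1 / 2 * (1 / (M : ℝ))) :=
          Real.log_le_log (by norm_num) (by have : 0 < 1 / (M : ℝ) := by positivity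
                                            linarith)
        rw [one_div, Real.log_inv] at this
        rw [one_div]
        linarith
      · simp only [h, ne_eq, not_false_eq_true, if_true, if_false, mul_zero, zero_add, one_mul]
        rw [Real.log_mul (by norm_num) (by positivity), one_div, one_div, Real.log_inv,
          Real.log_inv]
        linarith
    nlinarith
  rw [← errorProb_eq, hμ.2, ← nent_eq_neg_sum] at key
  linarith

/-- Given the input at time `i`, the output at time `i` is independent of the other outputs. -/
theorem law_codePmf_memoryless (W : Channel X Y Z) (c : Code X Y M n) (π : Y × Z → B) (i : Fin n)
    (v : (Fin n → Y × Z) → C) (hv : ∀ w a, v (Function.update w i a) = v w) (a : C) (x : X)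
    (b : B) :
    law (codePmf W c) (fun ω => ((v ω.2, c.enc ω.1 i), π (ω.2 i))) ((a, x), b) =
      law (codePmf W c) (fun ω => (v ω.2, c.enc ω.1 i)) (a, x) * law (W.prob x) π b := by
  classical
  rw [law_eq_sum_ite, law_eq_sum_ite, law_eq_sum_ite, Fintype.sum_prod_type, Fintype.sum_prod_type,
    Finset.sum_mul]
  refine Finset.sum_congr rfl fun m _ => ?_
  simp only [codePmf, mul_assoc]
  rw [← Finset.mul_sum, ← Finset.mul_sum, mul_assoc]
  congr 1
  rw [sum_pi_resample (fun j => W.prob (c.enc m j)) i (W.prob_mem _).2]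
  simp only [hv, Function.update_self, Finset.sum_mul, Prod.mk.injEq]
  refine Finset.sum_congr rfl fun w _ => ?_
  rw [mul_assoc]
  congr 1
  by_cases h : v w = a ∧ c.enc m i = x
  · simp [h.1, h.2]
  · rw [if_neg h]
    simp [h]

end CodeLaw

/-! ### Single-letterization of the information of a code -/

section Marginal

variable {Ω A B C : Type*} [Fintype Ω]

theorem sum_law_prod [Fintype B] (μ : Ω → ℝ) (f : Ω → A) (g : Ω → B) (a : A) :
    ∑ b, law μ (fun ω => (f ω, g ω)) (a, b) = law μ f a := by
  classical
  simp only [law_eq_sum_ite]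
  rw [Finset.sum_comm]
  simp [Prod.ext_iff, ite_and]

theorem sum_law_prod_prod [Fintype B] (μ : Ω → ℝ) (f : Ω → A) (g : Ω → B) (h : Ω → C) (a : A)
    (c : C) :
    ∑ b, law μ (fun ω => ((f ω, g ω), h ω)) ((a, b), c) = law μ (fun ω => (f ω, h ω)) (a, c) := by
  classical
  simp only [law_eq_sum_ite]
  rw [Finset.sum_comm]
  refine Finset.sum_congr rfl fun ω _ => ?_
  by_cases h1 : f ω = a <;> by_cases h2 : h ω = c <;> simp [Prod.ext_iff, h1, h2]

theorem law_le_law_comp [Fintype A] {μ : Ω → ℝ} (hμ : ∀ ω, 0 ≤ μ ω) (f : Ω → A) (φ : A → B) (a : A) :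
    law μ f a ≤ law μ (fun ω => φ (f ω)) (φ a) := by
  rw [← law_law μ f φ]
  exact le_law_self (law_nonneg hμ f) φ a

/-- The entropy of a sequence is at most that of independent copies of its average marginal. -/
theorem nent_le_average [Fintype B] {μ : Ω → ℝ} (hμ : μ ∈ stdSimplex ℝ Ω) {n : ℕ} (hn : 0 < n)
    (f : Ω → Fin n → B) :
    nent μ f ≤ n * ∑ b, Real.negMulLog ((1 / n : ℝ) * ∑ i, law μ (fun ω => f ω i) b) := by
  set Q : B → ℝ := fun b => (1 / n : ℝ) * ∑ i, law μ (fun ω => f ω i) b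
  have hn' : (0 : ℝ) < n := by positivity
  have hQ0 : ∀ b, 0 ≤ Q b := fun b =>
    mul_nonneg (by positivity) (Finset.sum_nonneg fun i _ => law_nonneg hμ.1 _ _)
  have hQ1 : ∑ b, Q b = 1 := by
    simp only [Q]
    rw [← Finset.mul_sum, Finset.sum_comm]
    simp only [sum_law, hμ.2]
    simp [hn'.ne']
  have hzero : ∀ b : Fin n → B, law μ f b ≠ 0 → ∀ i, Q (b i) ≠ 0 := by
    intro b hb i
    have h1 : 0 < law μ f b := (law_nonneg hμ.1 f b).lt_of_ne' hb
    have h2 := law_le_law_comp hμ.1 f (fun b => b i) b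
    have h3 : law μ (fun ω => f ω i) (b i) ≤ ∑ j, law μ (fun ω => f ω j) (b i) :=
      Finset.single_le_sum (f := fun j => law μ (fun ω => f ω j) (b i))
        (fun j _ => law_nonneg hμ.1 _ _) (Finset.mem_univ i)
    exact (mul_pos (by positivity) (h1.trans_le (h2.trans h3))).ne'
  -- The reference distribution is the n-fold product of the average marginal; its log-likelihood
  -- sees only the one-coordinate laws.
  have G := sum_negMulLog_le (p := law μ f) (q := fun b => ∏ i, Q (b i)) (law_nonneg hμ.1 f)
    (fun b => Finset.prod_nonneg fun i _ => hQ0 _)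
    (fun b hb => by
      by_contra h
      exact Finset.prod_ne_zero_iff.2 (fun i _ => hzero b h i) hb)
    (by rw [sum_law, hμ.2, sum_pi_prod_eq_one fun _ => hQ1])
  have e : ∀ b, law μ f b * Real.log (∏ i, Q (b i)) = law μ f b * ∑ i, Real.log (Q (b i)) := by
    intro b
    by_cases h : law μ f b = 0
    · simp [h]
    · rw [Real.log_prod fun i _ => hzero b h i]
  rw [Finset.sum_congr rfl fun b _ => e b, sum_law_mul μ f (fun b => ∑ i, Real.log (Q (b i)))] at G
  have e2 : ∑ ω, μ ω * ∑ i, Real.log (Q (f ω i)) = n * ∑ b, Q b * Real.log (Q b) := by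
    simp only [Finset.mul_sum]
    rw [Finset.sum_comm]
    have : ∀ i, ∑ ω, μ ω * Real.log (Q (f ω i)) =
        ∑ b, law μ (fun ω => f ω i) b * Real.log (Q b) := fun i =>
      (sum_law_mul μ (fun ω => f ω i) (fun b => Real.log (Q b))).symm
    rw [Finset.sum_congr rfl fun i _ => this i, Finset.sum_comm]
    refine Finset.sum_congr rfl fun b _ => ?_
    rw [← Finset.sum_mul, ← mul_assoc]
    congr 1
    simp only [Q]
    field_simp
  rw [e2, ← mul_neg, ← Finset.sum_neg_distrib] at G
  simpa only [nent, Real.negMulLog, neg_mul] using G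

end Marginal

/-! ### Past, future and hybrid output sequences -/

section SideOutputs

variable {Y Z : Type*} {n : ℕ}

/-- The `Y`-outputs before time `i` and the `Z`-outputs after time `i`. -/
def sideOutputs (i : Fin n) (w : Fin n → Y × Z) (j : Fin n) : Option (Y ⊕ Z) :=
  if j < i then some (.inl (w j).1) else if i < j then some (.inr (w j).2) else none

/-- The `Y`-outputs before time `k` and the `Z`-outputs from time `k` on. -/
def hybridOutputs (k : ℕ) (w : Fin n → Y × Z) (j : Fin n) : Y ⊕ Z :=
  if (j : ℕ) < k then .inl (w j).1 else .inr (w j).2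

/-- The `Z`-outputs from time `k` on. -/
def futureOutputs (k : ℕ) (w : Fin n → Y × Z) (j : Fin n) : Option Z :=
  if (j : ℕ) < k then none else some (w j).2

/-- Entry i is masked by `none`; hence `law_codePmf_memoryless` applies and the side outputs can
serve as the auxiliary variable at time i. -/
theorem sideOutputs_update (i : Fin n) (w : Fin n → Y × Z) (a : Y × Z) :
    sideOutputs i (Function.update w i a) = sideOutputs i w := by
  ext1 j
  by_cases h : j = i
  · subst h; simp [sideOutputs]
  · simp [sideOutputs, Function.update_of_ne h]

/-- Describing fibres coordinate by coordinate reduces, through `nent_congr`, the identification of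
output tuples to propositional logic. -/
theorem sideOutputs_eq_iff (i : Fin n) (w w' : Fin n → Y × Z) :
    sideOutputs i w = sideOutputs i w' ↔
      (∀ j : Fin n, (j : ℕ) < i → (w j).1 = (w' j).1) ∧
        ∀ j : Fin n, (i : ℕ) < j → (w j).2 = (w' j).2 := by
  simp only [funext_iff, sideOutputs, Fin.lt_def]
  refine ⟨fun h => ⟨fun j hj => ?_, fun j hj => ?_⟩, fun h j => ?_⟩
  · simpa [hj] using h j
  · simpa [hj, hj.not_gt] using h j
  · split_ifs with h1 h2
    · rw [h.1 j h1]
    · rw [h.2 j h2]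
    · rfl

theorem hybridOutputs_eq_iff (k : ℕ) (w w' : Fin n → Y × Z) :
    hybridOutputs k w = hybridOutputs k w' ↔
      (∀ j : Fin n, (j : ℕ) < k → (w j).1 = (w' j).1) ∧
        ∀ j : Fin n, k ≤ (j : ℕ) → (w j).2 = (w' j).2 := by
  simp only [funext_iff, hybridOutputs]
  refine ⟨fun h => ⟨fun j hj => ?_, fun j hj => ?_⟩, fun h j => ?_⟩
  · simpa [hj] using h j
  · simpa [hj.not_gt] using h j
  · split_ifs with h1
    · rw [h.1 j h1]
    · rw [h.2 j (not_lt.1 h1)]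

theorem futureOutputs_eq_iff (k : ℕ) (w w' : Fin n → Y × Z) :
    futureOutputs k w = futureOutputs k w' ↔
      ∀ j : Fin n, k ≤ (j : ℕ) → (w j).2 = (w' j).2 := by
  simp only [funext_iff, futureOutputs]
  refine ⟨fun h j hj => ?_, fun h j => ?_⟩
  · simpa [hj.not_gt] using h j
  · split_ifs with h1
    · rfl
    · rw [h j (not_lt.1 h1)]

theorem forall_lt_succ_iff (i : Fin n) (P : Fin n → Prop) :
    (∀ j : Fin n, (j : ℕ) < (i : ℕ) + 1 → P j) ↔ (∀ j : Fin n, (j : ℕ) < i → P j) ∧ P i := by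
  refine ⟨fun h => ⟨fun j hj => h j (by omega), h i (by omega)⟩, fun h j hj => ?_⟩
  rcases (Nat.lt_succ_iff_lt_or_eq.1 hj) with h1 | h1
  · exact h.1 j h1
  · rw [Fin.ext h1]; exact h.2

theorem forall_le_iff (i : Fin n) (P : Fin n → Prop) :
    (∀ j : Fin n, (i : ℕ) ≤ j → P j) ↔ (∀ j : Fin n, (i : ℕ) < j → P j) ∧ P i := by
  refine ⟨fun h => ⟨fun j hj => h j hj.le, h i le_rfl⟩, fun h j hj => ?_⟩
  rcases hj.lt_or_eq with h1 | h1
  · exact h.1 j h1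
  · rw [← Fin.ext h1]; exact h.2

end SideOutputs

/-! ### The Csiszár–Körner identity and the auxiliary variable of a code -/

section SingleLetter

variable {X Y Z B C : Type*} [Fintype Y] [Fintype Z] {M n : ℕ}

theorem noiseEntropy_eq_sum [Fintype B] (W : Channel X Y Z) (c : Code X Y M n) (K : X → B → ℝ) :
    noiseEntropy K c.enc =
      ∑ i, ∑ ω, codePmf W c ω * ∑ b, Real.negMulLog (K (c.enc ω.1 i) b) := by
  have h1 : ∀ m, ∑ b : Fin n → Y × Z, ∏ i, law (W.prob (c.enc m i)) id (b i) = 1 := fun m =>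
    sum_pi_prod_eq_one fun i => by rw [sum_law, (W.prob_mem _).2]
  have h2 : ∀ i, ∑ ω, codePmf W c ω * ∑ b, Real.negMulLog (K (c.enc ω.1 i) b) =
      1 / (M : ℝ) * ∑ m, ∑ b, Real.negMulLog (K (c.enc m i) b) := by
    intro i
    rw [sum_codePmf_mul W c id (fun m _ => ∑ b, Real.negMulLog (K (c.enc m i) b))]
    simp only [← Finset.sum_mul, h1, one_mul]
  rw [noiseEntropy, Finset.sum_congr rfl fun i _ => h2 i, ← Finset.mul_sum, Finset.sum_comm]

theorem sum_law_mul_kernel [Fintype X] (W : Channel X Y Z) (c : Code X Y M n) (π : Y × Z → B)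
    (i : Fin n) (v : (Fin n → Y × Z) → C) (hv : ∀ w a, v (Function.update w i a) = v w) (a : C)
    (b : B) :
    ∑ x, law (codePmf W c) (fun ω => (v ω.2, c.enc ω.1 i)) (a, x) * law (W.prob x) π b =
      law (codePmf W c) (fun ω => (v ω.2, π (ω.2 i))) (a, b) := by
  simp only [← law_codePmf_memoryless W c π i v hv]
  exact sum_law_prod_prod _ _ _ _ _ _

/-- This is I(Xᵢ;Yᵢ|V) = H(V,Yᵢ) − H(V) − H(Yᵢ|Xᵢ), where Yᵢ is independent of V given Xᵢ. -/
theorem sum_chanInfo_law [Fintype X] [Fintype B] [Fintype C] (W : Channel X Y Z) (c : Code X Y M n)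
    (π : Y × Z → B) (i : Fin n) (v : (Fin n → Y × Z) → C)
    (hv : ∀ w a, v (Function.update w i a) = v w) :
    ∑ a, chanInfo (fun x => law (W.prob x) π)
        (fun x => law (codePmf W c) (fun ω => (v ω.2, c.enc ω.1 i)) (a, x)) =
      nent (codePmf W c) (fun ω => (v ω.2, π (ω.2 i))) - nent (codePmf W c) (fun ω => v ω.2) -
        ∑ ω, codePmf W c ω * ∑ b, Real.negMulLog (law (W.prob (c.enc ω.1 i)) π b) := by
  simp only [chanInfo, Finset.sum_sub_distrib, sum_law_mul_kernel W c π i v hv]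
  congr 1
  · congr 1
    · rw [nent, Fintype.sum_prod_type]
    · rw [nent]
      simp only [sum_law_prod]
  · rw [← sum_law_mul (codePmf W c)
      (fun ω : Fin M × (Fin n → Y × Z) => (v ω.2, c.enc ω.1 i))
      (fun a => ∑ b, Real.negMulLog (law (W.prob a.2) π b)), Fintype.sum_prod_type]

variable {Ω : Type*} [Fintype Ω]

/-- Filling the gap at i with a Y-output yields the hybrid sequence switching at i + 1; filling it
with a Z-output yields the one switching at i. This makes the sum identity telescope. -/
theorem nent_sideOutputs_left (μ : Ω → ℝ) (w : Ω → Fin n → Y × Z) (i : Fin n) :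
    nent μ (fun ω => (sideOutputs i (w ω), (w ω i).1)) =
      nent μ (fun ω => hybridOutputs (i + 1) (w ω)) := by
  refine nent_congr μ fun ω ω' => ?_
  rw [Prod.mk.injEq, sideOutputs_eq_iff, hybridOutputs_eq_iff, forall_lt_succ_iff]
  simp only [Nat.succ_le_iff]
  tauto

theorem nent_sideOutputs_right (μ : Ω → ℝ) (w : Ω → Fin n → Y × Z) (i : Fin n) :
    nent μ (fun ω => (sideOutputs i (w ω), (w ω i).2)) =
      nent μ (fun ω => hybridOutputs i (w ω)) := by
  refine nent_congr μ fun ω ω' => ?_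
  rw [Prod.mk.injEq, sideOutputs_eq_iff, hybridOutputs_eq_iff, forall_le_iff]
  tauto

/-- The sum identity of Csiszár and Körner. -/
theorem sum_nent_sideOutputs_sub (μ : Ω → ℝ) (w : Ω → Fin n → Y × Z) :
    ∑ i, (nent μ (fun ω => (sideOutputs i (w ω), (w ω i).1)) -
        nent μ (fun ω => (sideOutputs i (w ω), (w ω i).2))) =
      nent μ (fun ω i => (w ω i).1) - nent μ (fun ω i => (w ω i).2) := by
  simp only [nent_sideOutputs_left, nent_sideOutputs_right]
  rw [Fin.sum_univ_eq_sum_range (fun k => nent μ (fun ω => hybridOutputs (k + 1) (w ω)) -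
    nent μ (fun ω => hybridOutputs k (w ω))), Finset.sum_range_sub
    (fun k => nent μ (fun ω => hybridOutputs k (w ω)))]
  congr 1
  · refine nent_congr μ fun ω ω' => ?_
    rw [hybridOutputs_eq_iff, funext_iff]
    exact ⟨fun h j => h.1 j j.2, fun h => ⟨fun j _ => h j, fun j hj => absurd j.2 (not_lt.2 hj)⟩⟩
  · refine nent_congr μ fun ω ω' => ?_
    rw [hybridOutputs_eq_iff, funext_iff]
    exact ⟨fun h j => h.2 j (Nat.zero_le _), fun h => ⟨fun j hj => absurd hj (Nat.not_lt_zero _),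
      fun j _ => h j⟩⟩

/-- The side outputs contain the Z-outputs after i, so conditioning on them leaves at most H(Zᵢ |
Zᵢ₊₁,…,Zₙ); these entropies add up to H(Zⁿ) by the chain rule. -/
theorem sum_nent_sideOutputs_le {μ : Ω → ℝ} (hμ : μ ∈ stdSimplex ℝ Ω) (w : Ω → Fin n → Y × Z) :
    ∑ i, (nent μ (fun ω => (sideOutputs i (w ω), (w ω i).2)) -
        nent μ (fun ω => sideOutputs i (w ω))) ≤ nent μ (fun ω i => (w ω i).2) := by
  set S : ℕ → ℝ := fun k => nent μ (fun ω => futureOutputs k (w ω))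
  have hstep : ∀ i : Fin n, nent μ (fun ω => (sideOutputs i (w ω), (w ω i).2)) -
      nent μ (fun ω => sideOutputs i (w ω)) ≤ S i - S (i + 1) := by
    intro i
    have h := nent_submodular hμ.1 (fun ω => (w ω i).2) (fun ω => sideOutputs i (w ω))
      (fun ω => futureOutputs (i + 1) (w ω))
    have e1 : nent μ (fun ω => ((w ω i).2, sideOutputs i (w ω), futureOutputs (i + 1) (w ω))) =
        nent μ (fun ω => (sideOutputs i (w ω), (w ω i).2)) := by
      refine nent_congr μ fun ω ω' => ?_
      simp only [Prod.mk.injEq, sideOutputs_eq_iff, futureOutputs_eq_iff, Nat.succ_le_iff]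
      tauto
    have e2 : nent μ (fun ω => ((w ω i).2, futureOutputs (i + 1) (w ω))) = S i := by
      refine nent_congr μ fun ω ω' => ?_
      simp only [Prod.mk.injEq, futureOutputs_eq_iff, Nat.succ_le_iff]
      rw [forall_le_iff]
      tauto
    have e3 : nent μ (fun ω => (sideOutputs i (w ω), futureOutputs (i + 1) (w ω))) =
        nent μ (fun ω => sideOutputs i (w ω)) := by
      refine nent_congr μ fun ω ω' => ?_
      simp only [Prod.mk.injEq, sideOutputs_eq_iff, futureOutputs_eq_iff, Nat.succ_le_iff]
      tauto
    rw [e1, e2, e3] at h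
    simp only [S] at h ⊢
    linarith
  refine (Finset.sum_le_sum fun i _ => hstep i).trans ?_
  rw [Fin.sum_univ_eq_sum_range (fun k => S k - S (k + 1)), Finset.sum_range_sub']
  have h0 : S 0 = nent μ (fun ω i => (w ω i).2) := by
    refine nent_congr μ fun ω ω' => ?_
    rw [futureOutputs_eq_iff, funext_iff]
    simp
  have hn : S n = 0 := by
    refine nent_const hμ.2 fun ω ω' => ?_
    rw [futureOutputs_eq_iff]
    exact fun j hj => absurd j.2 (not_lt.2 hj)
  rw [h0, hn, sub_zero]

/-- Every code induces a pmf `p(u, x)` whose single-letter quantities bound the information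
transmitted by the code to the two receivers. -/
theorem exists_pmf_of_code [Fintype X] (W : Channel X Y Z) (c : Code X Y M n) (hM : 0 < M)
    (hn : 0 < n) :
    ∃ p ∈ stdSimplex ℝ ((Fin n × (Fin n → Option (Y ⊕ Z))) × X),
      nent (codePmf W c) (fun ω i => (ω.2 i).1) - noiseEntropy W.toY c.enc ≤
        n * chanInfo W.toY (fun x => ∑ u, p (u, x)) ∧
      n * ∑ u, chanInfo W.toZ (fun x => p (u, x)) ≤
        nent (codePmf W c) (fun ω i => (ω.2 i).2) - noiseEntropy W.toZ c.enc ∧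
      n * (∑ u, chanInfo W.toY (fun x => p (u, x)) - ∑ u, chanInfo W.toZ (fun x => p (u, x))) =
        (nent (codePmf W c) (fun ω i => (ω.2 i).1) - noiseEntropy W.toY c.enc) -
        (nent (codePmf W c) (fun ω i => (ω.2 i).2) - noiseEntropy W.toZ c.enc) := by
  set μ := codePmf W c
  have hμ : μ ∈ stdSimplex ℝ _ := codePmf_mem W c hM
  have hn' : (0 : ℝ) < n := by positivity
  set q : Fin n → (Fin n → Option (Y ⊕ Z)) × X → ℝ := fun i =>
    law μ (fun ω => (sideOutputs i ω.2, c.enc ω.1 i))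
  have hqX : ∀ i x, ∑ a, q i (a, x) = law μ (fun ω => c.enc ω.1 i) x := by
    intro i x
    have : law μ (fun ω => c.enc ω.1 i) x = law (q i) Prod.snd x := by rw [law_law]
    classical
    rw [this, law_eq_sum_ite, Fintype.sum_prod_type]
    simp
  have hY : ∀ i, ∑ a, chanInfo W.toY (fun x => q i (a, x)) = _ := fun i =>
    sum_chanInfo_law W c Prod.fst i (sideOutputs i) (sideOutputs_update i)
  have hZ : ∀ i, ∑ a, chanInfo W.toZ (fun x => q i (a, x)) = _ := fun i =>
    sum_chanInfo_law W c Prod.snd i (sideOutputs i) (sideOutputs_update i)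
  have hYs : n * ∑ u : Fin n × (Fin n → Option (Y ⊕ Z)),
      chanInfo W.toY (fun x => 1 / (n : ℝ) * q u.1 (u.2, x)) =
        ∑ i, ∑ a, chanInfo W.toY (fun x => q i (a, x)) := by
    simp only [chanInfo_smul fun x => (W.toY_mem x).2]
    rw [← Finset.mul_sum, Fintype.sum_prod_type]
    field_simp
  have hZs : n * ∑ u : Fin n × (Fin n → Option (Y ⊕ Z)),
      chanInfo W.toZ (fun x => 1 / (n : ℝ) * q u.1 (u.2, x)) =
        ∑ i, ∑ a, chanInfo W.toZ (fun x => q i (a, x)) := by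
    simp only [chanInfo_smul fun x => (W.toZ_mem x).2]
    rw [← Finset.mul_sum, Fintype.sum_prod_type]
    field_simp
  -- The factor 1/n makes the time index, the first component of U, uniform.
  refine ⟨fun a => 1 / (n : ℝ) * q a.1.1 (a.1.2, a.2), ⟨fun a => mul_nonneg (by positivity)
    (law_nonneg hμ.1 _ _), ?_⟩, ?_, ?_, ?_⟩
  · rw [← Finset.mul_sum, Fintype.sum_prod_type, Fintype.sum_prod_type]
    have : ∀ i, ∑ a, ∑ x, q i (a, x) = 1 := fun i => by
      rw [← Fintype.sum_prod_type', ← hμ.2, ← sum_law μ (fun ω => (sideOutputs i ω.2, c.enc ω.1 i))]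
    simp only [this]
    simp [hn'.ne']
  · have hsum : ∀ x, ∑ u : Fin n × (Fin n → Option (Y ⊕ Z)), 1 / (n : ℝ) * q u.1 (u.2, x) =
        1 / n * ∑ i, law μ (fun ω => c.enc ω.1 i) x := by
      intro x
      rw [← Finset.mul_sum, Fintype.sum_prod_type]
      simp only [hqX]
    have hone : ∑ x, 1 / (n : ℝ) * ∑ i, law μ (fun ω => c.enc ω.1 i) x = 1 := by
      rw [← Finset.mul_sum, Finset.sum_comm]
      simp only [sum_law, hμ.2]
      simp [hn'.ne']
    have hker : ∀ i y, ∑ x, law μ (fun ω => c.enc ω.1 i) x * W.toY x y =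
        law μ (fun ω => (ω.2 i).1) y := by
      intro i y
      simp only [← hqX, Finset.sum_mul]
      have h : ∀ a, ∑ x, q i (a, x) * W.toY x y =
          law μ (fun ω => (sideOutputs i ω.2, (ω.2 i).1)) (a, y) := fun a =>
        sum_law_mul_kernel W c Prod.fst i (sideOutputs i) (sideOutputs_update i) a y
      rw [Finset.sum_comm, Finset.sum_congr rfl fun a _ => h a]
      have : law μ (fun ω => (ω.2 i).1) y =
        law (law μ (fun ω => (sideOutputs i ω.2, (ω.2 i).1))) Prod.snd y := by rw [law_law]
      classical
      rw [this, law_eq_sum_ite, Fintype.sum_prod_type]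
      simp [μ]
    simp only [hsum]
    -- After summing out U the input law is the time average. The output entropy is then handled by
    -- `nent_le_average`, and the noise term, being linear in the input law, is an equality.
    rw [chanInfo_eq_of_sum_eq_one hone, mul_sub]
    refine sub_le_sub ?_ (le_of_eq ?_)
    · refine (nent_le_average hμ hn (fun ω i => (ω.2 i).1)).trans (le_of_eq ?_)
      congr 1
      refine Finset.sum_congr rfl fun y _ => ?_
      congr 1
      simp only [mul_assoc, ← Finset.mul_sum, Finset.sum_mul]
      rw [Finset.sum_comm]
      simp only [hker]
    · rw [noiseEntropy_eq_sum W c]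
      simp only [mul_assoc, ← Finset.mul_sum, Finset.sum_mul]
      rw [Finset.sum_comm, ← mul_assoc, mul_one_div_cancel hn'.ne', one_mul]
      exact Finset.sum_congr rfl fun i _ => sum_law_mul μ (fun ω => c.enc ω.1 i)
        (fun x => ∑ y, Real.negMulLog (W.toY x y))
  · rw [hZs, Finset.sum_congr rfl fun i _ => hZ i, Finset.sum_sub_distrib,
      noiseEntropy_eq_sum W c]
    exact sub_le_sub_right (sum_nent_sideOutputs_le hμ (fun ω => ω.2)) _
  · rw [mul_sub, hYs, hZs, Finset.sum_congr rfl fun i _ => hZ i,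
      Finset.sum_congr rfl fun i _ => hY i, Finset.sum_sub_distrib, Finset.sum_sub_distrib,
      Finset.sum_sub_distrib, Finset.sum_sub_distrib, noiseEntropy_eq_sum W c,
      noiseEntropy_eq_sum W c]
    have h := sum_nent_sideOutputs_sub μ (fun ω : Fin M × (Fin n → Y × Z) => ω.2)
    rw [Finset.sum_sub_distrib] at h
    simp only [Channel.toY, Channel.toZ]
    simp only [μ] at h ⊢
    linarith

end SingleLetter

/-! ### The cardinality bound -/

section Support

variable {U E : Type*} [Fintype U] [AddCommGroup E] [Module ℝ E]

/-- If more than `dim E` weights are nonzero, then one of them can be made zero without changing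
the weighted sum of the `v u`, and without decreasing the weighted sum of the `b u`. -/
theorem exists_smaller_support [FiniteDimensional ℝ E] (v : U → E) (b : U → ℝ) (l : E →ₗ[ℝ] ℝ)
    (t : U → ℝ) (ht : ∀ u, 0 ≤ t u) (hl : ∀ u, t u ≠ 0 → 0 < l (v u))
    (hcard : Module.finrank ℝ E < #{u | t u ≠ 0}) :
    ∃ t' : U → ℝ, (∀ u, 0 ≤ t' u) ∧ (∀ u, t u = 0 → t' u = 0) ∧ (∃ u, t u ≠ 0 ∧ t' u = 0) ∧
      ∑ u, t' u • v u = ∑ u, t u • v u ∧ ∑ u, t u * b u ≤ ∑ u, t' u * b u := by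
  classical
  set S : Finset U := {u | t u ≠ 0}
  have hdep : ¬LinearIndependent ℝ (fun u : S => v u) := fun h => by
    have := h.fintype_card_le_finrank
    rw [Fintype.card_coe] at this
    omega
  obtain ⟨g, hg0, ⟨u₀, hS₀⟩, hg1⟩ := Fintype.not_linearIndependent_iff.1 hdep
  -- A linear dependence on the support, extended by zero, with its sign chosen so that moving along
  -- it does not lower the objective.
  obtain ⟨s, hsS, hs0, hsb, hs1⟩ : ∃ s : U → ℝ, (∀ u, t u = 0 → s u = 0) ∧
      ∑ u, s u • v u = 0 ∧ 0 ≤ ∑ u, s u * b u ∧ ∃ u, s u ≠ 0 := by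
    set s : U → ℝ := fun u => if h : u ∈ S then g ⟨u, h⟩ else 0
    have h1 : ∀ u, t u = 0 → s u = 0 := fun u hu => dif_neg (by simp [S, hu])
    have h2 : ∑ u, s u • v u = 0 := by
      rw [← hg0, Finset.univ_eq_attach,
        ← Finset.sum_subset (Finset.subset_univ S) fun u _ hu => by simp [s, hu],
        ← Finset.sum_attach S]
      exact Finset.sum_congr rfl fun u _ => by simp [s]
    have h3 : s u₀ ≠ 0 := by simpa [s, hS₀] using hg1
    rcases le_total 0 (∑ u, s u * b u) with h | h
    · exact ⟨s, h1, h2, h, u₀, h3⟩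
    · exact ⟨fun u => -s u, fun u hu => by simp [h1 u hu], by simp [h2], by simpa using h, u₀,
        by simpa using h3⟩
  -- Applying l, which is positive on the supporting vectors, to the dependence rules out
  -- coefficients that are all nonnegative.
  obtain ⟨u₁, hu₁⟩ : ∃ u, s u < 0 := by
    by_contra! hneg
    have hsum : ∑ u, s u * l (v u) = 0 := by
      have := congrArg l hs0
      simpa [map_sum] using this
    have hterm : ∀ u, 0 ≤ s u * l (v u) := fun u => by
      by_cases h : t u = 0
      · simp [hsS u h]
      · exact mul_nonneg (hneg u) (hl u h).le
    obtain ⟨u, hu⟩ := hs1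
    have := (Finset.sum_eq_zero_iff_of_nonneg fun u _ => hterm u).1 hsum u (Finset.mem_univ u)
    exact (mul_ne_zero hu (hl u fun h => hu (hsS u h)).ne') this
  obtain ⟨u₂, hu₂, hmin⟩ := Finset.exists_min_image (univ.filter fun u => s u < 0)
    (fun u => t u / -s u) ⟨u₁, by simpa using hu₁⟩
  have hu₂ : s u₂ < 0 := by simpa using hu₂
  -- The largest step that keeps all weights nonnegative; it makes the weight at u₂ vanish.
  set θ := t u₂ / -s u₂
  have hθ : 0 ≤ θ := div_nonneg (ht _) (by linarith)
  refine ⟨fun u => t u + θ * s u, fun u => ?_, fun u hu => by simp [hu, hsS u hu],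
    ⟨u₂, fun h => hu₂.ne (hsS u₂ h), ?_⟩, ?_, ?_⟩
  · rcases lt_or_ge (s u) 0 with h | h
    · have := hmin u (by simpa using h)
      rw [le_div_iff₀ (by linarith)] at this
      linarith
    · have := mul_nonneg hθ h
      linarith [ht u]
  · have : θ * -s u₂ = t u₂ := div_mul_cancel₀ _ (by linarith)
    linarith
  · simp only [add_smul, Finset.sum_add_distrib, mul_smul, ← Finset.smul_sum, hs0, smul_zero,
      add_zero]
  · simp only [add_mul, Finset.sum_add_distrib, mul_assoc, ← Finset.mul_sum]
    exact le_add_of_nonneg_right (mul_nonneg hθ hsb)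

/-- Carathéodory with an objective, by induction on the support size. Positivity of l on the
supporting vectors plays the role of total mass, so dim E points suffice instead of dim E + 1. -/
theorem exists_support_le_finrank [FiniteDimensional ℝ E] (v : U → E) (b : U → ℝ)
    (l : E →ₗ[ℝ] ℝ) (t : U → ℝ) (ht : ∀ u, 0 ≤ t u) (hl : ∀ u, t u ≠ 0 → 0 < l (v u)) :
    ∃ t' : U → ℝ, (∀ u, 0 ≤ t' u) ∧ ∑ u, t' u • v u = ∑ u, t u • v u ∧
      ∑ u, t u * b u ≤ ∑ u, t' u * b u ∧ #{u | t' u ≠ 0} ≤ Module.finrank ℝ E := by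
  induction hk : #{u | t u ≠ 0} using Nat.strong_induction_on generalizing t with
  | _ k ih =>
    rcases le_or_gt k (Module.finrank ℝ E) with h | h
    · exact ⟨t, ht, rfl, le_rfl, hk ▸ h⟩
    · obtain ⟨t₁, h0, h1, ⟨u, hu, hu'⟩, h2, h3⟩ :=
        exists_smaller_support v b l t ht hl (hk ▸ h)
      have hlt : #{u | t₁ u ≠ 0} < k := by
        rw [← hk]
        refine Finset.card_lt_card (Finset.ssubset_iff_of_subset (fun w hw => ?_) |>.2
          ⟨u, by simpa using hu, by simpa using hu'⟩)
        simp only [Finset.mem_filter, Finset.mem_univ, true_and] at hw ⊢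
        exact fun hw' => hw (h1 w hw')
      obtain ⟨t', a1, a2, a3, a4⟩ := ih _ hlt t₁ h0 (fun w hw => hl w fun hw' => hw (h1 w hw')) rfl
      exact ⟨t', a1, a2.trans h2, h3.trans a3, a4⟩

end Support

section Cardinality

variable {X B C U : Type*} [Fintype X] [Fintype B] [Fintype C] [Fintype U]

theorem chanInfo_zero (K : X → B → ℝ) : chanInfo K (fun _ => 0) = 0 := by simp [chanInfo]

theorem continuous_sum_chanInfo (K : X → B → ℝ) :
    Continuous fun p : U × X → ℝ => (∑ u, chanInfo K (fun x => p (u, x))) / Real.log 2 :=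
  (continuous_finsetSum _ fun u _ => (continuous_chanInfo K).comp (by fun_prop)).div_const _

/-- The auxiliary alphabet may be taken to have `|X| + 1` elements. -/
theorem exists_pmf_fin {K : X → B → ℝ} {L : X → C → ℝ} (hK : ∀ x, ∑ b, K x b = 1)
    (hL : ∀ x, ∑ b, L x b = 1) {p : U × X → ℝ} (hp : p ∈ stdSimplex ℝ (U × X)) :
    ∃ p' ∈ stdSimplex ℝ (Fin (Fintype.card X + 1) × X),
      (∀ x, ∑ u, p' (u, x) = ∑ u, p (u, x)) ∧
      ∑ u, chanInfo L (fun x => p' (u, x)) = ∑ u, chanInfo L (fun x => p (u, x)) ∧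
      ∑ u, chanInfo K (fun x => p (u, x)) ≤ ∑ u, chanInfo K (fun x => p' (u, x)) := by
  classical
  -- Zero rows must start with weight 0, since the functional l, the row mass, has to be positive on
  -- the support.
  set t : U → ℝ := fun u => if ∑ x, p (u, x) = 0 then 0 else 1
  have hrow : ∀ u, ∑ x, p (u, x) = 0 → (fun x => p (u, x)) = fun _ => 0 := fun u hu => by
    ext x
    exact (Finset.sum_eq_zero_iff_of_nonneg fun x _ => hp.1 (u, x)).1 hu x (Finset.mem_univ x)
  -- What is preserved is the information through L and the input law, |X| + 1 coordinates in all.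
  -- The information through K is only the objective, so it costs no dimension.
  obtain ⟨t', h0, hv, hb, hcard⟩ := exists_support_le_finrank
    (fun u : U => ((chanInfo L fun x => p (u, x), fun x => p (u, x)) : ℝ × (X → ℝ)))
    (fun u => chanInfo K fun x => p (u, x))
    ((∑ x, LinearMap.proj x : (X → ℝ) →ₗ[ℝ] ℝ) ∘ₗ LinearMap.snd ℝ ℝ (X → ℝ)) t
    (fun u => by simp only [t]; split_ifs <;> norm_num)
    (fun u hu => by
      have hu' : ∑ x, p (u, x) ≠ 0 := fun h => hu (if_pos h)
      simpa using (Finset.sum_nonneg fun x _ => hp.1 (u, x)).lt_of_ne' hu')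
  have hfin : Module.finrank ℝ (ℝ × (X → ℝ)) = Fintype.card X + 1 := by
    simp [add_comm]
  rw [hfin] at hcard
  have ht1 : ∀ (F : U → ℝ), (∀ u, ∑ x, p (u, x) = 0 → F u = 0) → ∑ u, t u * F u = ∑ u, F u :=
    fun F hF => Finset.sum_congr rfl fun u _ => by
      by_cases h : ∑ x, p (u, x) = 0
      · simp [hF u h]
      · simp [t, h]
  have hvX : ∀ x, ∑ u, t' u * p (u, x) = ∑ u, p (u, x) := by
    intro x
    have := congrFun (congrArg Prod.snd hv) x
    simp only [Prod.snd_sum, Prod.smul_mk, Finset.sum_apply, Pi.smul_apply, smul_eq_mul] at this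
    rw [this]
    exact ht1 _ fun u hu => congrFun (hrow u hu) x
  have hvL : ∑ u, t' u * chanInfo L (fun x => p (u, x)) = ∑ u, chanInfo L fun x => p (u, x) := by
    have := congrArg Prod.fst hv
    simp only [Prod.fst_sum, Prod.smul_mk, smul_eq_mul] at this
    rw [this]
    exact ht1 _ fun u hu => by rw [hrow u hu, chanInfo_zero]
  rw [ht1 _ fun u hu => by rw [hrow u hu, chanInfo_zero]] at hb
  set S : Finset U := {u | t' u ≠ 0}
  obtain ⟨e⟩ : Nonempty (S ↪ Fin (Fintype.card X + 1)) :=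
    Function.Embedding.nonempty_of_card_le (by simpa using hcard)
  set p' : Fin (Fintype.card X + 1) × X → ℝ := fun a =>
    ∑ u : S, if e u = a.1 then t' u * p (u, a.2) else 0
  have hrow1 : ∀ u : S, (fun x => p' (e u, x)) = fun x => t' u * p (u, x) := fun u => by
    ext x
    simp [p', e.injective.eq_iff]
  have hrow2 : ∀ k, k ∉ Set.range e → (fun x => p' (k, x)) = fun _ => 0 := fun k hk => by
    ext x
    exact Finset.sum_eq_zero fun u _ => if_neg fun h => hk ⟨u, h⟩
  have hsum : ∀ F : (X → ℝ) → ℝ, F (fun _ => 0) = 0 →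
      ∑ k, F (fun x => p' (k, x)) = ∑ u, F (fun x => t' u * p (u, x)) := by
    intro F hF
    have h1 : ∑ u : S, F (fun x => p' (e u, x)) = ∑ k, F (fun x => p' (k, x)) := by
      rw [← Finset.sum_map univ e (fun k => F fun x => p' (k, x))]
      refine Finset.sum_subset (Finset.subset_univ _) fun k _ hk => ?_
      rw [hrow2 k (by simpa using hk), hF]
    rw [← h1]
    simp only [hrow1]
    rw [Finset.sum_coe_sort S (fun u => F fun x => t' u * p (u, x))]
    refine Finset.sum_subset (Finset.subset_univ _) fun u _ hu => ?_
    have : t' u = 0 := by simpa [S] using hu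
    simpa [this] using hF
  have hX : ∀ x, ∑ u, p' (u, x) = ∑ u, p (u, x) := fun x =>
    (hsum (fun q => q x) rfl).trans (hvX x)
  refine ⟨p', ⟨fun a => Finset.sum_nonneg fun u _ => ?_, ?_⟩, hX, ?_, ?_⟩
  · split_ifs
    · exact mul_nonneg (h0 _) (hp.1 _)
    · exact le_rfl
  · rw [Fintype.sum_prod_type_right]
    simp only [hX]
    rw [← hp.2, Fintype.sum_prod_type_right]
  · rw [hsum (chanInfo L) (chanInfo_zero L)]
    simp only [chanInfo_smul hL, hvL]
  · rw [hsum (chanInfo K) (chanInfo_zero K)]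
    simpa only [chanInfo_smul hK] using hb

end Cardinality

/-! ### The converse -/

section Converse

variable {X Y Z : Type*} [Fintype X] [Fintype Y] [Fintype Z]

/-- The region described by `p(u, x)` is closed under limits: slack in the three constraints can be
removed. -/
theorem exists_pmf_of_forall_slack (W : Channel X Y Z) {k : ℕ} {R D : ℝ}
    (h : ∀ ε > 0, ∃ p ∈ stdSimplex ℝ (Fin k × X), R - ε ≤ infoXY W p ∧
      infoXZgivenU W p ≤ D + ε ∧ R - D - ε ≤ infoXYgivenU W p - infoXZgivenU W p) :
    ∃ p ∈ stdSimplex ℝ (Fin k × X), R ≤ infoXY W p ∧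
      infoXZgivenU W p ≤ D ∧ R - D ≤ infoXYgivenU W p - infoXZgivenU W p := by
  have hpos : ∀ m : ℕ, (0 : ℝ) < 1 / ((m : ℝ) + 1) := fun m => Nat.one_div_pos_of_nat
  choose p hp h1 h2 h3 using fun m : ℕ => h _ (hpos m)
  -- Compactness needs one fixed simplex, hence an auxiliary alphabet that does not depend on ε.
  obtain ⟨q, hq, φ, hφ, hlim⟩ := (isCompact_stdSimplex ℝ (Fin k × X)).tendsto_subseq hp
  have heps : Filter.Tendsto (fun m => 1 / ((φ m : ℝ) + 1)) Filter.atTop (nhds 0) :=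
    (tendsto_one_div_add_atTop_nhds_zero_nat (𝕜 := ℝ)).comp hφ.tendsto_atTop
  have l1 : Filter.Tendsto (fun m => infoXY W (p (φ m))) Filter.atTop (nhds (infoXY W q)) := by
    simp only [infoXY_eq W (hp _).2, infoXY_eq W hq.2]
    have : Continuous fun p : Fin k × X → ℝ =>
        chanInfo W.toY (fun x => ∑ u, p (u, x)) / Real.log 2 :=
      ((continuous_chanInfo _).comp (by fun_prop)).div_const _
    exact (this.tendsto q).comp hlim
  have l2 : Filter.Tendsto (fun m => infoXZgivenU W (p (φ m))) Filter.atTop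
      (nhds (infoXZgivenU W q)) := by
    simp only [infoXZgivenU_eq]
    exact ((continuous_sum_chanInfo W.toZ).tendsto q).comp hlim
  have l3 : Filter.Tendsto (fun m => infoXYgivenU W (p (φ m))) Filter.atTop
      (nhds (infoXYgivenU W q)) := by
    simp only [infoXYgivenU_eq]
    exact ((continuous_sum_chanInfo W.toY).tendsto q).comp hlim
  refine ⟨q, hq, ?_, ?_, ?_⟩
  · have := le_of_tendsto_of_tendsto' (tendsto_const_nhds.sub heps) l1 fun m => h1 (φ m)
    simpa using this
  · have := le_of_tendsto_of_tendsto' l2 (tendsto_const_nhds.add heps) fun m => h2 (φ m)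
    simpa using this
  · have := le_of_tendsto_of_tendsto' (tendsto_const_nhds.sub heps) (l3.sub l2) fun m => h3 (φ m)
    simpa using this

/-- One block length suffices: n is taken so large that Fano's loss P(error)·R + 1/n and the excess
disturbance are each below ε/2. -/
theorem exists_pmf_of_achievable (W : Channel X Y Z) {R D : ℝ} (h : Achievable W R D) {ε : ℝ}
    (hε : 0 < ε) :
    ∃ p ∈ stdSimplex ℝ (Fin (Fintype.card X + 1) × X), R - ε ≤ infoXY W p ∧
      infoXZgivenU W p ≤ D + ε ∧ R - D - ε ≤ infoXYgivenU W p - infoXZgivenU W p := by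
  obtain ⟨hR, hD, c, herr, hlim⟩ := h
  have hlog : 0 < Real.log 2 := Real.log_pos (by norm_num)
  have hdist : ∀ᶠ n in Filter.atTop, disturbanceRate W (c n) < D + ε / 2 := by
    have h1 : Filter.limsup (fun n => (disturbanceRate W (c n) : EReal)) Filter.atTop <
        ((D + ε / 2 : ℝ) : EReal) := hlim.trans_lt (by exact_mod_cast (by linarith))
    filter_upwards [Filter.eventually_lt_of_limsup_lt h1] with n hn
    exact_mod_cast hn
  have hslack : Filter.Tendsto (fun n => errorProb W (c n) * R + 1 / (n : ℝ)) Filter.atTop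
      (nhds 0) := by
    simpa using (herr.mul_const R).add (tendsto_one_div_atTop_nhds_zero_nat (𝕜 := ℝ))
  obtain ⟨n, hn1, hn2, hn3, hn4⟩ := (hdist.and ((hslack.eventually (gt_mem_nhds
    (half_pos hε))).and ((Filter.eventually_gt_atTop 0).and
      (herr.eventually (gt_mem_nhds one_pos))))).exists
  have hn' : (0 : ℝ) < n := by positivity
  set M := numMessages R n
  have hMR : (2 : ℝ) ^ ((n : ℝ) * R) ≤ M := Nat.le_ceil _
  have hM : 0 < M := by
    have : (0 : ℝ) < M := lt_of_lt_of_le (by positivity) hMR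
    exact_mod_cast this
  have hlogM : n * R * Real.log 2 ≤ Real.log M := by
    rw [← Real.log_rpow (by norm_num)]
    exact Real.log_le_log (by positivity) hMR
  have hfano := fano W (c n) hM
  obtain ⟨p, hp, a1, a2, a3⟩ := exists_pmf_of_code W (c n) hM hn3
  obtain ⟨p', hp', b1, b2, b3⟩ := exists_pmf_fin (K := W.toY) (L := W.toZ)
    (fun x => (W.toY_mem x).2) (fun x => (W.toZ_mem x).2) hp
  set AY := nent (codePmf W (c n)) (fun ω i => (ω.2 i).1) - noiseEntropy W.toY (c n).enc
  set AZ := nent (codePmf W (c n)) (fun ω i => (ω.2 i).2) - noiseEntropy W.toZ (c n).enc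
  have hAZ : disturbanceRate W (c n) = 1 / n * (AZ / Real.log 2) := by
    rw [disturbanceRate, mutualInfo_codePmf W (c n) Prod.snd]
    rfl
  have hAY : (R - ε / 2) * (n * Real.log 2) ≤ AY := by
    have h1 : (1 - errorProb W (c n)) * (n * R * Real.log 2) ≤
        (1 - errorProb W (c n)) * Real.log M :=
      mul_le_mul_of_nonneg_left hlogM (by linarith)
    have h2 : (errorProb W (c n) * R + 1 / (n : ℝ)) * (n * Real.log 2) ≤
        ε / 2 * (n * Real.log 2) := mul_le_mul_of_nonneg_right hn2.le (by positivity)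
    have h3 : 1 / (n : ℝ) * (n * Real.log 2) = Real.log 2 := by field_simp
    nlinarith
  have hAZ' : AZ ≤ (D + ε / 2) * (n * Real.log 2) := by
    rw [hAZ] at hn1
    have h1 := mul_le_mul_of_nonneg_right hn1.le (by positivity : 0 ≤ n * Real.log 2)
    have h2 : 1 / (n : ℝ) * (AZ / Real.log 2) * (n * Real.log 2) = AZ := by field_simp
    linarith
  have hnl : 0 < n * Real.log 2 := by positivity
  refine ⟨p', hp', ?_, ?_, ?_⟩
  · rw [infoXY_eq W hp'.2]
    simp only [b1]
    rw [le_div_iff₀ hlog]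
    nlinarith
  · rw [infoXZgivenU_eq, b2, div_le_iff₀ hlog]
    nlinarith
  · rw [infoXZgivenU_eq, infoXYgivenU_eq, b2, ← sub_div, le_div_iff₀ hlog]
    have h1 : (R - D - ε) * (n * Real.log 2) ≤ AY - AZ := by nlinarith
    rw [← a3] at h1
    have h2 : (R - D - ε) * Real.log 2 ≤ ∑ u, chanInfo W.toY (fun x => p (u, x)) -
        ∑ u, chanInfo W.toZ (fun x => p (u, x)) := by nlinarith
    linarith

theorem region_subset (W : Channel X Y Z) {r : ℝ × ℝ} (hr : r ∈ rateDisturbanceRegion W) :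
    0 ≤ r.1 ∧ 0 ≤ r.2 ∧ ∃ p ∈ stdSimplex ℝ (Fin (Fintype.card X + 1) × X),
      r.1 ≤ infoXY W p ∧ infoXZgivenU W p ≤ r.2 ∧
      r.1 - r.2 ≤ infoXYgivenU W p - infoXZgivenU W p := by
  have hr' : r ∈ closure {r : ℝ × ℝ | Achievable W r.1 r.2} := hr
  have hnn : r ∈ {r : ℝ × ℝ | 0 ≤ r.1 ∧ 0 ≤ r.2} := by
    have hsub : {r : ℝ × ℝ | Achievable W r.1 r.2} ⊆ {r : ℝ × ℝ | 0 ≤ r.1 ∧ 0 ≤ r.2} :=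
      fun s hs => ⟨hs.1, hs.2.1⟩
    exact closure_minimal hsub ((isClosed_le continuous_const continuous_fst).inter
      (isClosed_le continuous_const continuous_snd)) hr'
  refine ⟨hnn.1, hnn.2, exists_pmf_of_forall_slack W fun ε hε => ?_⟩
  -- The constraint on the difference collects three errors: one from each coordinate and one from
  -- the slack at s.
  obtain ⟨s, hs, hd⟩ := Metric.mem_closure_iff.1 hr' (ε / 3) (by positivity)
  rw [Prod.dist_eq, max_lt_iff, Real.dist_eq, Real.dist_eq, abs_lt, abs_lt] at hd
  obtain ⟨p, hp, h1, h2, h3⟩ := exists_pmf_of_achievable W hs (ε := ε / 3) (by positivity)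
  exact ⟨p, hp, by linarith, by linarith, by linarith⟩

end Converse

/-! ### One-shot superposition coding -/

section OneShot

/-- The selection step of random coding. Positive weight matters: it keeps each codeword in the
support of Q given its cloud centre. -/
theorem exists_pos_le_of_sum_mul_le {Ω : Type*} [Fintype Ω] {w : Ω → ℝ} (hw : w ∈ stdSimplex ℝ Ω)
    {F : Ω → ℝ} {b : ℝ} (h : ∑ ω, w ω * F ω ≤ b) : ∃ ω, 0 < w ω ∧ F ω ≤ b := by
  by_contra! hne
  obtain ⟨ω, -, hω⟩ : ∃ ω ∈ univ, w ω ≠ 0 := Finset.exists_ne_zero_of_sum_ne_zero (by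
    rw [hw.2]; exact one_ne_zero)
  have : ∑ ω, w ω * b < ∑ ω, w ω * F ω := by
    refine Finset.sum_lt_sum (fun ω _ => ?_) ⟨ω, Finset.mem_univ _, ?_⟩
    · rcases (hw.1 ω).eq_or_lt with h0 | h0
      · simp [← h0]
      · exact (mul_lt_mul_of_pos_left (hne ω h0) h0).le
    · have h0 := (hw.1 ω).lt_of_ne' hω
      exact mul_lt_mul_of_pos_left (hne ω h0) h0
  rw [← Finset.sum_mul, hw.2, one_mul] at this
  linarith

open Classical in
/-- Change of measure: an output distribution `q` rarely charges the outputs that a distribution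
`v` makes `s` times more likely. -/
theorem sum_mul_indicator_le {Y : Type*} [Fintype Y] {q v : Y → ℝ} (hv : v ∈ stdSimplex ℝ Y)
    {s : ℝ} (hs : 0 < s) : ∑ y, q y * (if s * q y < v y then 1 else 0) ≤ 1 / s := by
  refine le_of_le_of_eq (Finset.sum_le_sum (g := fun y => v y / s) fun y _ => ?_)
    (by rw [← Finset.sum_div, hv.2])
  split_ifs with h
  · rw [le_div_iff₀ hs]; linarith
  · simpa using div_nonneg (hv.1 y) hs.le

theorem sum_mul_le_of_mem {A : Type*} [Fintype A] {p : A → ℝ} (hp : p ∈ stdSimplex ℝ A)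
    {F : A → ℝ} {b : ℝ} (h : ∀ a, F a ≤ b) : ∑ a, p a * F a ≤ b := by
  calc ∑ a, p a * F a ≤ ∑ a, p a * b :=
        Finset.sum_le_sum fun a _ => mul_le_mul_of_nonneg_left (h a) (hp.1 a)
    _ = b := by rw [← Finset.sum_mul, hp.2, one_mul]

variable {U X Y : Type*} [Fintype U] [Fintype X] {M N : ℕ}

/-- The distribution of a random superposition codebook: independent cloud centres with pmf `P`,
and for each message `m` a codeword drawn from `Q` given the centre of its cloud `a m`. -/
def codebookPmf (P : U → ℝ) (Q : U → X → ℝ) (a : Fin M → Fin N)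
    (C : (Fin N → U) × (Fin M → X)) : ℝ :=
  (∏ k, P (C.1 k)) * ∏ m, Q (C.1 (a m)) (C.2 m)

variable {P : U → ℝ} {Q : U → X → ℝ}

theorem codebookPmf_mem (hP : P ∈ stdSimplex ℝ U) (hQ : ∀ u, Q u ∈ stdSimplex ℝ X)
    (a : Fin M → Fin N) : codebookPmf P Q a ∈ stdSimplex ℝ ((Fin N → U) × (Fin M → X)) := by
  refine ⟨fun C => mul_nonneg (Finset.prod_nonneg fun k _ => hP.1 _)
    (Finset.prod_nonneg fun m _ => (hQ _).1 _), ?_⟩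
  simp only [codebookPmf, Fintype.sum_prod_type, ← Finset.mul_sum]
  have : ∀ u : Fin N → U, ∑ x : Fin M → X, ∏ m, Q (u (a m)) (x m) = 1 := fun u =>
    sum_pi_prod_eq_one fun m => (hQ (u (a m))).2
  simp only [this, mul_one]
  exact sum_pi_prod_eq_one fun _ => hP.2

theorem sum_codebookPmf_single (hP : P ∈ stdSimplex ℝ U) (hQ : ∀ u, Q u ∈ stdSimplex ℝ X)
    (a : Fin M → Fin N) (m : Fin M) (F : U → X → ℝ) :
    ∑ C, codebookPmf P Q a C * F (C.1 (a m)) (C.2 m) = ∑ u, P u * ∑ x, Q u x * F u x := by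
  simp only [codebookPmf, Fintype.sum_prod_type, mul_assoc, ← Finset.mul_sum]
  have : ∀ u : Fin N → U, ∑ x : Fin M → X, (∏ l, Q (u (a l)) (x l)) * F (u (a m)) (x m) =
      ∑ c, Q (u (a m)) c * F (u (a m)) c := fun u =>
    sum_pi_apply (fun l => (hQ (u (a l))).2) m (F (u (a m)))
  simp only [this]
  exact sum_pi_apply (fun _ => hP.2) (a m) (fun u => ∑ c, Q u c * F u c)

/-- Codewords of one cloud are independent given their common centre. -/
theorem sum_codebookPmf_same (hP : P ∈ stdSimplex ℝ U) (hQ : ∀ u, Q u ∈ stdSimplex ℝ X)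
    (a : Fin M → Fin N) {m m' : Fin M} (hm : m ≠ m') (ha : a m = a m') (F : U → X → X → ℝ) :
    ∑ C, codebookPmf P Q a C * F (C.1 (a m)) (C.2 m) (C.2 m') =
      ∑ u, P u * ∑ x, Q u x * ∑ x', Q u x' * F u x x' := by
  simp only [codebookPmf, Fintype.sum_prod_type, mul_assoc, ← Finset.mul_sum]
  have : ∀ u : Fin N → U,
      ∑ x : Fin M → X, (∏ l, Q (u (a l)) (x l)) * F (u (a m)) (x m) (x m') =
        ∑ c, Q (u (a m)) c * ∑ c', Q (u (a m)) c' * F (u (a m)) c c' := fun u => by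
    rw [sum_pi_apply_apply (fun l => (hQ (u (a l))).2) hm (F (u (a m))), ← ha]
  simp only [this]
  exact sum_pi_apply (fun _ => hP.2) (a m)
    (fun u => ∑ c, Q u c * ∑ c', Q u c' * F u c c')

/-- Codewords of different clouds have independent centres, so they are independent outright. -/
theorem sum_codebookPmf_ne (hP : P ∈ stdSimplex ℝ U) (hQ : ∀ u, Q u ∈ stdSimplex ℝ X)
    (a : Fin M → Fin N) {m m' : Fin M} (ha : a m ≠ a m') (F : X → X → ℝ) :
    ∑ C, codebookPmf P Q a C * F (C.2 m) (C.2 m') =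
      ∑ u, P u * ∑ u', P u' * ∑ x, Q u x * ∑ x', Q u' x' * F x x' := by
  simp only [codebookPmf, Fintype.sum_prod_type, mul_assoc, ← Finset.mul_sum]
  have : ∀ u : Fin N → U,
      ∑ x : Fin M → X, (∏ l, Q (u (a l)) (x l)) * F (x m) (x m') =
        ∑ c, Q (u (a m)) c * ∑ c', Q (u (a m')) c' * F c c' := fun u =>
    sum_pi_apply_apply (fun l => (hQ (u (a l))).2) (fun h => ha (by rw [h])) F
  simp only [this]
  exact sum_pi_apply_apply (fun _ => hP.2) ha
    (fun u u' => ∑ c, Q u c * ∑ c', Q u' c' * F c c')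

/-- The output distribution of the channel `V` with input distribution `q`. -/
def outPmf (q : X → ℝ) (V : X → Y → ℝ) (y : Y) : ℝ := ∑ x, q x * V x y

variable [Fintype Y] {V : X → Y → ℝ}

open Classical in
-- Given the centre u, the rival codeword is independent of the output, whose law is then `outPmf (Q
-- u) V`; `sum_mul_indicator_le` applies for each fixed rival.
theorem sum_codebookPmf_same_le (hP : P ∈ stdSimplex ℝ U) (hQ : ∀ u, Q u ∈ stdSimplex ℝ X)
    (hV : ∀ x, V x ∈ stdSimplex ℝ Y) (a : Fin M → Fin N) {m m' : Fin M} (hm : m ≠ m')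
    (ha : a m = a m') {s : ℝ} (hs : 0 < s) :
    ∑ C, codebookPmf P Q a C * ∑ y, V (C.2 m) y *
      (if s * outPmf (Q (C.1 (a m))) V y < V (C.2 m') y then 1 else 0) ≤ 1 / s := by
  rw [sum_codebookPmf_same hP hQ a hm ha (fun u x x' => ∑ y, V x y *
    (if s * outPmf (Q u) V y < V x' y then 1 else 0))]
  refine sum_mul_le_of_mem hP fun u => ?_
  have : ∑ x, Q u x * ∑ x', Q u x' * ∑ y, V x y *
      (if s * outPmf (Q u) V y < V x' y then 1 else 0) =
      ∑ x', Q u x' * ∑ y, outPmf (Q u) V y *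
        (if s * outPmf (Q u) V y < V x' y then 1 else 0) := by
    simp only [Finset.mul_sum]
    rw [Finset.sum_comm]
    refine Finset.sum_congr rfl fun x' _ => ?_
    rw [Finset.sum_comm]
    refine Finset.sum_congr rfl fun y _ => ?_
    conv_rhs => rw [mul_comm (outPmf (Q u) V y)]
    rw [← mul_assoc]
    conv_rhs => rw [outPmf, Finset.mul_sum]
    exact Finset.sum_congr rfl fun x _ => by rw [← outPmf]; ring
  rw [this]
  exact sum_mul_le_of_mem (hQ u) fun x' => sum_mul_indicator_le (hV x') hs

open Classical in
theorem sum_codebookPmf_ne_le (hP : P ∈ stdSimplex ℝ U) (hQ : ∀ u, Q u ∈ stdSimplex ℝ X)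
    (hV : ∀ x, V x ∈ stdSimplex ℝ Y) (a : Fin M → Fin N) {m m' : Fin M}
    (ha : a m ≠ a m') {s : ℝ} (hs : 0 < s) :
    ∑ C, codebookPmf P Q a C * ∑ y, V (C.2 m) y *
      (if s * outPmf P (fun u => outPmf (Q u) V) y < V (C.2 m') y then 1 else 0) ≤ 1 / s := by
  set q := outPmf P (fun u => outPmf (Q u) V) with hq
  rw [sum_codebookPmf_ne hP hQ a ha (fun x x' => ∑ y, V x y *
    (if s * q y < V x' y then 1 else 0))]
  have : ∑ u, P u * ∑ u', P u' * ∑ x, Q u x * ∑ x', Q u' x' * ∑ y, V x y *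
      (if s * q y < V x' y then 1 else 0) =
      ∑ u', P u' * ∑ x', Q u' x' * ∑ y, q y * (if s * q y < V x' y then 1 else 0) := by
    have e : ∀ y, q y = ∑ u, ∑ x, P u * (Q u x * V x y) := fun y => by
      simp only [hq, outPmf, Finset.mul_sum]
    set I : X → Y → ℝ := fun x' y => if s * q y < V x' y then 1 else 0
    change ∑ u, P u * ∑ u', P u' * ∑ x, Q u x * ∑ x', Q u' x' * ∑ y, V x y * I x' y =
      ∑ u', P u' * ∑ x', Q u' x' * ∑ y, q y * I x' y
    simp only [e, Finset.mul_sum, Finset.sum_mul]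
    rw [Finset.sum_comm]
    refine Finset.sum_congr rfl fun u' _ => ?_
    have h1 : ∀ u, ∑ x, ∑ x', ∑ y, P u * (P u' * (Q u x * (Q u' x' * (V x y * I x' y)))) =
        ∑ x', ∑ y, ∑ x, P u * (P u' * (Q u x * (Q u' x' * (V x y * I x' y)))) := fun u => by
      rw [Finset.sum_comm]
      exact Finset.sum_congr rfl fun x' _ => Finset.sum_comm
    rw [Finset.sum_congr rfl fun u _ => h1 u, Finset.sum_comm]
    refine Finset.sum_congr rfl fun x' _ => ?_
    rw [Finset.sum_comm]
    exact Finset.sum_congr rfl fun y _ => Finset.sum_congr rfl fun u _ =>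
      Finset.sum_congr rfl fun x _ => by ring
  rw [this]
  exact sum_mul_le_of_mem hP fun u' => sum_mul_le_of_mem (hQ u') fun x' =>
    sum_mul_indicator_le (hV x') hs

open Classical in
/-- One-shot superposition coding: for a linear cost `d`, some codebook has small error
probability and small cost simultaneously. -/
theorem exists_superposition_code (hP : P ∈ stdSimplex ℝ U) (hQ : ∀ u, Q u ∈ stdSimplex ℝ X)
    (hV : ∀ x, V x ∈ stdSimplex ℝ Y) (a : Fin M → Fin N) (hM : 0 < M) {s₁ s₂ : ℝ}
    (hs₁ : 0 < s₁) (hs₂ : 0 < s₂) (L : ℕ) (hL : ∀ m, #{m' | m' ≠ m ∧ a m' = a m} ≤ L)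
    (d : U → X → ℝ) {κ : ℝ} (hκ : 0 ≤ κ) :
    ∃ (u : Fin N → U) (x : Fin M → X) (dec : Y → Fin M), (∀ m, 0 < Q (u (a m)) (x m)) ∧
      κ * (1 / (M : ℝ) * ∑ m, ∑ y, V (x m) y * (if dec y ≠ m then 1 else 0)) +
        1 / (M : ℝ) * ∑ m, d (u (a m)) (x m) ≤
      κ * (∑ u, P u * ∑ x, Q u x * ∑ y, V x y *
          ((if V x y ≤ s₁ * outPmf P (fun u => outPmf (Q u) V) y then 1 else 0) +
            (if V x y ≤ s₂ * outPmf (Q u) V y then 1 else 0)) +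
        ((M : ℝ) - 1) / s₁ + L / s₂) + ∑ u, P u * ∑ x, Q u x * d u x := by
  set q := outPmf P (fun u => outPmf (Q u) V) with hq
  set w := codebookPmf P Q a
  have hw := codebookPmf_mem hP hQ a
  have hM' : (0 : ℝ) < M := by positivity
  -- Two likelihood tests: against the overall output law, which excludes other clouds, and against
  -- the output law of the message's own cloud.
  set pass : (Fin N → U) × (Fin M → X) → Fin M → Y → Prop := fun C m y =>
    s₁ * q y < V (C.2 m) y ∧ s₂ * outPmf (Q (C.1 (a m))) V y < V (C.2 m) y
  have hdec : ∀ C, ∃ dec : Y → Fin M, ∀ m y, dec y ≠ m →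
      pass C m y → ∃ m', m' ≠ m ∧ pass C m' y := by
    intro C
    -- The decoder picks any passing message, so an error means that the true message fails a test
    -- or that a rival passes. Message 0 is a default when none passes.
    refine ⟨fun y => if h : ∃ m, pass C m y then h.choose else ⟨0, hM⟩, fun m y hne hp => ?_⟩
    have h : ∃ m, pass C m y := ⟨m, hp⟩
    simp only [dif_pos h] at hne
    exact ⟨h.choose, hne, h.choose_spec⟩
  choose dec hdec using hdec
  set T : (Fin N → U) × (Fin M → X) → Fin M → ℝ := fun C m => ∑ y, V (C.2 m) y *
    ((if V (C.2 m) y ≤ s₁ * q y then 1 else 0) +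
      (if V (C.2 m) y ≤ s₂ * outPmf (Q (C.1 (a m))) V y then 1 else 0))
  -- For each rival only the test relevant to its cloud is kept: the second in the true cloud, the
  -- first elsewhere.
  set G : (Fin N → U) × (Fin M → X) → Fin M → Fin M → ℝ := fun C m m' =>
    if m' = m then 0 else if a m' = a m then ∑ y, V (C.2 m) y *
      (if s₂ * outPmf (Q (C.1 (a m))) V y < V (C.2 m') y then 1 else 0)
    else ∑ y, V (C.2 m) y * (if s₁ * q y < V (C.2 m') y then 1 else 0)
  have herr : ∀ C m, ∑ y, V (C.2 m) y * (if dec C y ≠ m then 1 else 0) ≤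
      T C m + ∑ m', G C m m' := by
    intro C m
    set g : Fin M → Y → ℝ := fun m' y => if m' = m then 0 else if a m' = a m then
      (if s₂ * outPmf (Q (C.1 (a m))) V y < V (C.2 m') y then 1 else 0)
      else (if s₁ * q y < V (C.2 m') y then 1 else 0)
    have hg0 : ∀ m' y, 0 ≤ g m' y := fun m' y => by simp only [g]; split_ifs <;> norm_num
    have hG : ∀ m', G C m m' = ∑ y, V (C.2 m) y * g m' y := fun m' => by
      simp only [G, g]; split_ifs <;> simp
    simp only [hG, T]
    rw [Finset.sum_comm, ← Finset.sum_add_distrib]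
    refine Finset.sum_le_sum fun y _ => ?_
    rw [← Finset.mul_sum, ← mul_add]
    refine mul_le_mul_of_nonneg_left ?_ ((hV _).1 y)
    have hsum0 : 0 ≤ ∑ m', g m' y := Finset.sum_nonneg fun m' _ => hg0 m' y
    by_cases hne : dec C y ≠ m
    · rw [if_pos hne]
      by_cases h1 : V (C.2 m) y ≤ s₁ * q y
      · rw [if_pos h1]; split_ifs <;> linarith
      by_cases h2 : V (C.2 m) y ≤ s₂ * outPmf (Q (C.1 (a m))) V y
      · rw [if_neg h1, if_pos h2]; linarith
      obtain ⟨m', hm', hp⟩ := hdec C m y hne ⟨not_le.1 h1, not_le.1 h2⟩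
      have hg1 : g m' y = 1 := by
        simp only [g, if_neg hm']
        split_ifs with h3 h4 h4
        · rfl
        · rw [← h3] at h4; exact absurd hp.2 h4
        · rfl
        · exact absurd hp.1 h4
      have := Finset.single_le_sum (fun m' _ => hg0 m' y) (Finset.mem_univ m')
      rw [if_neg h1, if_neg h2]
      linarith
    · rw [if_neg hne]
      have h0 : ∀ p : Prop, (0 : ℝ) ≤ if p then 1 else 0 := fun p => by split_ifs <;> norm_num
      have h1 := h0 (V (C.2 m) y ≤ s₁ * q y)
      have h2 := h0 (V (C.2 m) y ≤ s₂ * outPmf (Q (C.1 (a m))) V y)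
      linarith
  have hEG : ∀ m, ∑ C, w C * ∑ m', G C m m' ≤ ((M : ℝ) - 1) / s₁ + L / s₂ := by
    intro m
    simp only [Finset.mul_sum]
    rw [Finset.sum_comm]
    have hb : ∀ m', ∑ C, w C * G C m m' ≤ (if m' ≠ m then 1 / s₁ else 0) +
        (if m' ≠ m ∧ a m' = a m then 1 / s₂ else 0) := by
      intro m'
      by_cases h1 : m' = m
      · simp [G, h1]
      · by_cases h2 : a m' = a m
        · simp only [G, if_neg h1, if_pos h2]
          have := sum_codebookPmf_same_le hP hQ hV a (Ne.symm h1) h2.symm hs₂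
          simp only [h1, h2, ne_eq, not_false_eq_true, and_self, if_true]
          have h3 : 0 < 1 / s₁ := by positivity
          linarith
        · simp only [G, if_neg h1, if_neg h2]
          have := sum_codebookPmf_ne_le hP hQ hV a (Ne.symm h2) hs₁
          simpa [h1, h2] using this
    refine (Finset.sum_le_sum fun m' _ => hb m').trans ?_
    rw [Finset.sum_add_distrib, ← Finset.sum_filter, ← Finset.sum_filter, Finset.sum_const,
      Finset.sum_const, nsmul_eq_mul, nsmul_eq_mul, mul_one_div, mul_one_div]
    refine add_le_add (le_of_eq ?_) ?_
    · congr 1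
      rw [Finset.filter_ne', Finset.card_erase_of_mem (Finset.mem_univ m), Finset.card_univ,
        Fintype.card_fin, Nat.cast_sub hM, Nat.cast_one]
    · exact div_le_div_of_nonneg_right (by exact_mod_cast hL m) hs₂.le
  have hET : ∀ m, ∑ C, w C * T C m = ∑ u, P u * ∑ x, Q u x * ∑ y, V x y *
          ((if V x y ≤ s₁ * q y then 1 else 0) +
            (if V x y ≤ s₂ * outPmf (Q u) V y then 1 else 0)) := fun m =>
    sum_codebookPmf_single hP hQ a m (fun u x => ∑ y, V x y *
          ((if V x y ≤ s₁ * q y then 1 else 0) +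
            (if V x y ≤ s₂ * outPmf (Q u) V y then 1 else 0)))
  set T₀ := ∑ u, P u * ∑ x, Q u x * ∑ y, V x y *
          ((if V x y ≤ s₁ * q y then 1 else 0) +
            (if V x y ≤ s₂ * outPmf (Q u) V y then 1 else 0))
  have hEd : ∀ m, ∑ C, w C * d (C.1 (a m)) (C.2 m) = ∑ u, P u * ∑ x, Q u x * d u x := fun m =>
    sum_codebookPmf_single hP hQ a m d
  have hmean : ∑ C, w C * (κ * (1 / (M : ℝ) * ∑ m, ∑ y, V (C.2 m) y *
      (if dec C y ≠ m then 1 else 0)) + 1 / (M : ℝ) * ∑ m, d (C.1 (a m)) (C.2 m)) ≤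
      κ * (T₀ + ((M : ℝ) - 1) / s₁ + L / s₂) + ∑ u, P u * ∑ x, Q u x * d u x := by
    calc _ ≤ ∑ C, w C * (κ * (1 / (M : ℝ) * ∑ m, (T C m + ∑ m', G C m m')) +
          1 / (M : ℝ) * ∑ m, d (C.1 (a m)) (C.2 m)) := by
          refine Finset.sum_le_sum fun C _ => mul_le_mul_of_nonneg_left ?_ (hw.1 C)
          refine add_le_add_left (mul_le_mul_of_nonneg_left (mul_le_mul_of_nonneg_left
            (Finset.sum_le_sum fun m _ => herr C m) (by positivity)) hκ) _
      _ = κ * (1 / (M : ℝ) * ∑ m, (∑ C, w C * T C m + ∑ C, w C * ∑ m', G C m m')) +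
          1 / (M : ℝ) * ∑ m, ∑ C, w C * d (C.1 (a m)) (C.2 m) := by
          simp only [← Finset.sum_add_distrib, ← mul_add]
          rw [Finset.sum_comm, Finset.sum_comm (s := univ (α := Fin M))]
          simp only [mul_add, Finset.sum_add_distrib, Finset.mul_sum]
          congr 1
          · congr 1
            all_goals
              refine Finset.sum_congr rfl fun C _ => ?_
              simp only [← Finset.mul_sum]
              ring
          · refine Finset.sum_congr rfl fun C _ => Finset.sum_congr rfl fun m _ => by ring
      _ ≤ κ * (1 / (M : ℝ) * ∑ _m : Fin M, (T₀ + (((M : ℝ) - 1) / s₁ + L / s₂))) +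
          1 / (M : ℝ) * ∑ _m : Fin M, ∑ u, P u * ∑ x, Q u x * d u x := by
          simp only [hEd, hET]
          refine add_le_add_left (mul_le_mul_of_nonneg_left (mul_le_mul_of_nonneg_left
            (Finset.sum_le_sum fun m _ => add_le_add_right (hEG m) _) (by positivity)) hκ) _
      _ = _ := by
          simp only [Finset.sum_const, Finset.card_univ, Fintype.card_fin, nsmul_eq_mul]
          field_simp
          ring
  obtain ⟨C, hC, hle⟩ := exists_pos_le_of_sum_mul_le hw hmean
  refine ⟨C.1, C.2, dec C, fun m => ?_, hle⟩
  refine ((hQ _).1 _).lt_of_ne' fun h0 => hC.ne' ?_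
  simp only [codebookPmf]
  rw [Finset.prod_eq_zero (Finset.mem_univ m) h0, mul_zero]

end OneShot

/-! ### Block codes -/

section Chernoff

variable {A : Type*} [Fintype A]

open Classical in
/-- If `v` exceeds `exp t * r` on average on the logarithmic scale, then the product of the `v`
falls below that of the `exp t * r` with exponentially small probability. -/
theorem exists_chernoff {q : A → ℝ} (hq : q ∈ stdSimplex ℝ A) {v r : A → ℝ}
    (hv : ∀ a, 0 < q a → 0 < v a) (hr : ∀ a, 0 < q a → 0 < r a) {t : ℝ}
    (ht : t < ∑ a, q a * (Real.log (v a) - Real.log (r a))) :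
    ∃ ρ : ℝ, 0 ≤ ρ ∧ ρ < 1 ∧ ∀ n : ℕ, ∑ a : Fin n → A, (∏ i, q (a i)) *
      (if ∏ i, v (a i) ≤ Real.exp (n * t) * ∏ i, r (a i) then 1 else 0) ≤ ρ ^ n := by
  set g : A → ℝ := fun a => Real.log (v a) - Real.log (r a) - t
  -- Chernoff bound: φ 0 = 1 and the derivative at 0 is t minus the mean log-ratio, which is
  -- negative, so φ s < 1 for some s > 0.
  set φ : ℝ → ℝ := fun s => ∑ a, q a * Real.exp (-(s * g a))
  have hφ0 : φ 0 = 1 := by simp [φ, hq.2]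
  have hderiv : HasDerivAt φ (∑ a, q a * (Real.exp (-(0 * g a)) * -(1 * g a))) 0 :=
    HasDerivAt.fun_sum fun a _ =>
      ((((hasDerivAt_id' (0 : ℝ)).mul_const (g a)).neg).exp).const_mul (q a)
  have hneg : ∑ a, q a * (Real.exp (-(0 * g a)) * -(1 * g a)) < 0 := by
    have : ∑ a, q a * (Real.exp (-(0 * g a)) * -(1 * g a)) =
        t - ∑ a, q a * (Real.log (v a) - Real.log (r a)) := by
      have h1 : t = ∑ a, q a * t := by rw [← Finset.sum_mul, hq.2, one_mul]
      conv_rhs => rw [h1]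
      rw [← Finset.sum_sub_distrib]
      refine Finset.sum_congr rfl fun a _ => ?_
      simp only [zero_mul, neg_zero, Real.exp_zero, g]
      ring
    rw [this]
    linarith
  obtain ⟨s, hs0, hs1⟩ : ∃ s : ℝ, 0 < s ∧ φ s < 1 := by
    have h1 := hasDerivAt_iff_tendsto_slope.1 hderiv
    have h2 : ∀ᶠ s in nhdsWithin (0 : ℝ) (Set.Ioi 0), slope φ 0 s < 0 :=
      (h1.mono_left (nhdsWithin_mono 0 fun s (hs : 0 < s) => hs.ne')).eventually (gt_mem_nhds hneg)
    obtain ⟨s, hs, hs'⟩ := (h2.and self_mem_nhdsWithin).exists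
    refine ⟨s, hs', ?_⟩
    have hs' : (0 : ℝ) < s := hs'
    rw [slope_def_field, hφ0, sub_zero, div_lt_iff₀ hs'] at hs
    linarith
  refine ⟨φ s, Finset.sum_nonneg fun a _ => mul_nonneg (hq.1 a) (Real.exp_pos _).le, hs1,
    fun n => ?_⟩
  rw [show φ s = ∑ a, q a * Real.exp (-(s * g a)) from rfl, Fintype.sum_pow]
  refine Finset.sum_le_sum fun a _ => ?_
  rw [Finset.prod_mul_distrib]
  refine (eq_or_ne (∏ i, q (a i)) 0).elim (fun h0 => by simp [h0]) fun h0 => ?_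
  have hpos : ∀ i, 0 < q (a i) := fun i =>
    (hq.1 _).lt_of_ne' (Finset.prod_ne_zero_iff.1 h0 i (Finset.mem_univ i))
  refine mul_le_mul_of_nonneg_left ?_ (Finset.prod_nonneg fun i _ => hq.1 _)
  split_ifs with h
  · rw [← Real.exp_sum, Real.one_le_exp_iff, Finset.sum_neg_distrib, ← Finset.mul_sum, neg_nonneg]
    refine mul_nonpos_of_nonneg_of_nonpos hs0.le ?_
    have h1 := Real.log_le_log (Finset.prod_pos fun i _ => hv _ (hpos i)) h
    rw [Real.log_mul (Real.exp_pos _).ne' (Finset.prod_pos fun i _ => hr _ (hpos i)).ne',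
      Real.log_exp, Real.log_prod fun i _ => (hv _ (hpos i)).ne',
      Real.log_prod fun i _ => (hr _ (hpos i)).ne'] at h1
    simp only [g, Finset.sum_sub_distrib, Finset.sum_const, Finset.card_univ, Fintype.card_fin,
      nsmul_eq_mul]
    linarith
  · exact Finset.prod_nonneg fun i _ => (Real.exp_pos _).le

end Chernoff

section Block

variable {U X Y : Type*} [Fintype X] {n : ℕ}

theorem sum_prod_arrow {A B : Type*} [Fintype A] [Fintype B] (F : (Fin n → A × B) → ℝ) :
    ∑ a : Fin n → A × B, F a = ∑ u : Fin n → A, ∑ v : Fin n → B, F (fun i => (u i, v i)) := by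
  rw [← (Equiv.arrowProdEquivProdArrow (Fin n) (fun _ => A) (fun _ => B)).symm.sum_comp,
    Fintype.sum_prod_type]
  rfl

theorem outPmf_nonneg {q : X → ℝ} {V : X → Y → ℝ} (hq : ∀ x, 0 ≤ q x) (hV : ∀ x y, 0 ≤ V x y)
    (y : Y) : 0 ≤ outPmf q V y :=
  Finset.sum_nonneg fun x _ => mul_nonneg (hq x) (hV x y)

theorem mul_le_outPmf {q : X → ℝ} {V : X → Y → ℝ} (hq : ∀ x, 0 ≤ q x) (hV : ∀ x y, 0 ≤ V x y)
    (x : X) (y : Y) : q x * V x y ≤ outPmf q V y :=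
  Finset.single_le_sum (f := fun x => q x * V x y) (fun x _ => mul_nonneg (hq x) (hV x y))
    (Finset.mem_univ x)

theorem outPmf_pi (q : Fin n → X → ℝ) (V : X → Y → ℝ) (y : Fin n → Y) :
    outPmf (fun x : Fin n → X => ∏ i, q i (x i)) (fun x y => ∏ i, V (x i) (y i)) y =
      ∏ i, outPmf (q i) V (y i) := by
  simp only [outPmf, ← Finset.prod_mul_distrib]
  exact sum_pi_prod fun i x => q i x * V x (y i)

variable [Fintype U] [Fintype Y]

theorem outPmf_mem {q : X → ℝ} {V : X → Y → ℝ} (hq : q ∈ stdSimplex ℝ X)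
    (hV : ∀ x, V x ∈ stdSimplex ℝ Y) : outPmf q V ∈ stdSimplex ℝ Y := by
  refine ⟨outPmf_nonneg hq.1 fun x => (hV x).1, ?_⟩
  simp only [outPmf]
  rw [Finset.sum_comm]
  simp only [← Finset.mul_sum, (hV _).2, mul_one, hq.2]

/-- `chanInfo` as an expected log-likelihood ratio. -/
theorem sum_mul_log_sub_log {q : X → ℝ} (hq : ∑ x, q x = 1) (V : X → Y → ℝ) :
    ∑ x, q x * ∑ y, V x y * (Real.log (V x y) - Real.log (outPmf q V y)) = chanInfo V q := by
  rw [chanInfo_eq_of_sum_eq_one hq]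
  simp only [mul_sub, Finset.sum_sub_distrib, Real.negMulLog, neg_mul, Finset.sum_neg_distrib,
    mul_neg]
  have : ∑ x, q x * ∑ y, V x y * Real.log (outPmf q V y) =
      ∑ y, (∑ x, q x * V x y) * Real.log (∑ x, q x * V x y) := by
    simp only [Finset.mul_sum, Finset.sum_mul]
    rw [Finset.sum_comm]
    exact Finset.sum_congr rfl fun y _ => Finset.sum_congr rfl fun x _ => by rw [outPmf]; ring
  rw [this]
  ring

variable {P : U → ℝ} {Q : U → X → ℝ} {V : X → Y → ℝ}

open Classical in
/-- The probability that a codeword fails a likelihood test with reference measure `r` below the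
mean log-likelihood ratio decays exponentially. -/
theorem exists_test_bound (hP : P ∈ stdSimplex ℝ U) (hQ : ∀ u, Q u ∈ stdSimplex ℝ X)
    (hV : ∀ x, V x ∈ stdSimplex ℝ Y) (r : U → Y → ℝ)
    (hr : ∀ u x y, 0 < P u → 0 < Q u x → 0 < V x y → 0 < r u y) {t : ℝ}
    (ht : t < ∑ u, P u * ∑ x, Q u x * ∑ y, V x y * (Real.log (V x y) - Real.log (r u y))) :
    ∃ ρ : ℝ, 0 ≤ ρ ∧ ρ < 1 ∧ ∀ n : ℕ, ∑ u : Fin n → U, (∏ i, P (u i)) *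
      ∑ x : Fin n → X, (∏ i, Q (u i) (x i)) * ∑ y : Fin n → Y, (∏ i, V (x i) (y i)) *
        (if ∏ i, V (x i) (y i) ≤ Real.exp (n * t) * ∏ i, r (u i) (y i) then 1 else 0) ≤ ρ ^ n := by
  have hq : (fun a : U × X × Y => P a.1 * (Q a.1 a.2.1 * V a.2.1 a.2.2)) ∈
      stdSimplex ℝ (U × X × Y) := by
    refine ⟨fun a => mul_nonneg (hP.1 _) (mul_nonneg ((hQ _).1 _) ((hV _).1 _)), ?_⟩
    simp only [Fintype.sum_prod_type, ← Finset.mul_sum, (hV _).2, mul_one, (hQ _).2, hP.2]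
  have hpos : ∀ a : U × X × Y, 0 < P a.1 * (Q a.1 a.2.1 * V a.2.1 a.2.2) →
      0 < P a.1 ∧ 0 < Q a.1 a.2.1 ∧ 0 < V a.2.1 a.2.2 := fun a ha => by
    refine ⟨(hP.1 _).lt_of_ne' fun h => ?_, ((hQ _).1 _).lt_of_ne' fun h => ?_,
      ((hV _).1 _).lt_of_ne' fun h => ?_⟩ <;> simp [h] at ha
  obtain ⟨ρ, h0, h1, h⟩ := exists_chernoff hq (v := fun a => V a.2.1 a.2.2)
    (r := fun a => r a.1 a.2.2) (t := t) (fun a ha => (hpos a ha).2.2)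
    (fun a ha => hr _ _ _ (hpos a ha).1 (hpos a ha).2.1 (hpos a ha).2.2) (by
      refine ht.trans_eq ?_
      simp only [Fintype.sum_prod_type, Finset.mul_sum]
      exact Finset.sum_congr rfl fun u _ => Finset.sum_congr rfl fun x _ =>
        Finset.sum_congr rfl fun y _ => by ring)
  refine ⟨ρ, h0, h1, fun n => le_of_eq_of_le ?_ (h n)⟩
  rw [sum_prod_arrow]
  refine Finset.sum_congr rfl fun u _ => ?_
  rw [sum_prod_arrow, Finset.mul_sum]
  refine Finset.sum_congr rfl fun x _ => ?_
  rw [Finset.mul_sum, Finset.mul_sum]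
  refine Finset.sum_congr rfl fun y _ => ?_
  simp only [Finset.prod_mul_distrib]
  ring

theorem sum_pi_cost (hP : P ∈ stdSimplex ℝ U) (hQ : ∀ u, Q u ∈ stdSimplex ℝ X)
    (d : U → X → ℝ) :
    ∑ u : Fin n → U, (∏ i, P (u i)) * ∑ x : Fin n → X, (∏ i, Q (u i) (x i)) *
      ∑ i, d (u i) (x i) = n * ∑ u, P u * ∑ x, Q u x * d u x := by
  have h1 : ∀ u : Fin n → U, ∑ x : Fin n → X, (∏ i, Q (u i) (x i)) * ∑ i, d (u i) (x i) =
      ∑ i, ∑ x, Q (u i) x * d (u i) x := fun u => by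
    simp only [Finset.mul_sum]
    rw [Finset.sum_comm]
    exact Finset.sum_congr rfl fun i _ => sum_pi_apply (fun j => (hQ (u j)).2) i (d (u i))
  simp only [h1]
  simp only [Finset.mul_sum (s := (univ : Finset (Fin n)))]
  rw [Finset.sum_comm, Finset.sum_congr rfl fun i _ =>
    sum_pi_apply (K := fun _ => P) (fun _ => hP.2) i (fun u => ∑ x, Q u x * d u x)]
  simp

end Block

/-! ### Disturbance of superposition codes -/

section Disturbance

variable {U X Y Z : Type*} [Fintype Y] [Fintype Z] {M N n : ℕ}
  {Q : U → X → ℝ}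

theorem errorProb_eq_average (W : Channel X Y Z) (c : Code X Y M n) [DecidableEq (Fin M)] :
    errorProb W c = 1 / (M : ℝ) * ∑ m, ∑ y : Fin n → Y, (∏ i, W.toY (c.enc m i) (y i)) *
      (if c.dec y ≠ m then 1 else 0) := by
  rw [errorProb_eq]
  exact sum_codePmf_mul W c Prod.fst (fun m y => if c.dec y ≠ m then 1 else 0)

variable [Fintype X]

/-- The disturbance of a superposition code is at most the logarithm of the number of clouds plus
the divergence from the output distributions generated by the cloud centres. -/
theorem nent_sub_noiseEntropy_le (W : Channel X Y Z) (c : Code X Y M n) (hM : 0 < M) (hN : 0 < N)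
    (hQ : ∀ u, Q u ∈ stdSimplex ℝ X) (a : Fin M → Fin N) (u : Fin N → Fin n → U)
    (hpos : ∀ m i, 0 < Q (u (a m) i) (c.enc m i)) :
    nent (codePmf W c) (fun ω i => (ω.2 i).2) - noiseEntropy W.toZ c.enc ≤
      Real.log N + 1 / (M : ℝ) * ∑ m, ∑ i, ∑ z, W.toZ (c.enc m i) z *
        (Real.log (W.toZ (c.enc m i) z) - Real.log (outPmf (Q (u (a m) i)) W.toZ z)) := by
  set μ := codePmf W c
  have hμ : μ ∈ stdSimplex ℝ _ := codePmf_mem W c hM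
  have hM' : (0 : ℝ) < M := by positivity
  have hN' : (0 : ℝ) < N := by positivity
  set f : Fin M × (Fin n → Y × Z) → Fin n → Z := fun ω i => (ω.2 i).2
  set R : Fin N → (Fin n → Z) → ℝ := fun k z => ∏ i, outPmf (Q (u k i)) W.toZ (z i)
  -- Reference law for Gibbs: the uniform mixture of the N cloud output laws. It dominates each of
  -- them divided by N, which costs log N.
  set q : (Fin n → Z) → ℝ := fun z => 1 / (N : ℝ) * ∑ k, R k z
  have hR0 : ∀ k z, 0 ≤ R k z := fun k z => Finset.prod_nonneg fun i _ =>
    outPmf_nonneg (hQ _).1 (fun x => (W.toZ_mem x).1) _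
  have hR1 : ∀ k, ∑ z, R k z = 1 := fun k =>
    sum_pi_prod_eq_one fun i => (outPmf_mem (hQ (u k i)) W.toZ_mem).2
  have hRpos : ∀ (m : Fin M) (z : Fin n → Z), ∏ i, W.toZ (c.enc m i) (z i) ≠ 0 →
      ∀ i, 0 < outPmf (Q (u (a m) i)) W.toZ (z i) := fun m z hz i => by
    have h1 : 0 < W.toZ (c.enc m i) (z i) :=
      ((W.toZ_mem _).1 _).lt_of_ne' (Finset.prod_ne_zero_iff.1 hz i (Finset.mem_univ i))
    exact (mul_pos (hpos m i) h1).trans_le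
      (mul_le_outPmf (hQ _).1 (fun x => (W.toZ_mem x).1) _ _)
  have hqR : ∀ k z, 1 / (N : ℝ) * R k z ≤ q z := fun k z =>
    mul_le_mul_of_nonneg_left
      (Finset.single_le_sum (f := fun k => R k z) (fun k _ => hR0 k z) (Finset.mem_univ k))
      (by positivity)
  have hexp : ∀ F : (Fin n → Z) → ℝ, ∑ ω, μ ω * F (f ω) = 1 / (M : ℝ) * ∑ m, ∑ z : Fin n → Z,
      (∏ i, W.toZ (c.enc m i) (z i)) * F z := fun F =>
    sum_codePmf_mul W c Prod.snd (fun _ z => F z)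
  have hlaw : ∀ z, law μ f z = 1 / (M : ℝ) * ∑ m, ∏ i, W.toZ (c.enc m i) (z i) := fun z => by
    classical
    rw [law_eq_sum_ite, hexp (fun z' => if z' = z then 1 else 0)]
    simp
  have G := sum_negMulLog_le (p := law μ f) (q := q) (law_nonneg hμ.1 f)
    (fun z => mul_nonneg (by positivity) (Finset.sum_nonneg fun k _ => hR0 k z))
    (fun z hz => by
      rw [hlaw, Finset.sum_eq_zero, mul_zero]
      intro m _
      by_contra hne
      have h1 : 0 < R (a m) z := Finset.prod_pos fun i _ => hRpos m z hne i
      have h2 := hqR (a m) z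
      rw [hz] at h2
      have h3 : 0 < 1 / (N : ℝ) * R (a m) z := by positivity
      linarith)
    (by
      rw [sum_law, hμ.2]
      simp only [q]
      rw [← Finset.mul_sum, Finset.sum_comm]
      simp [hR1, hN'.ne'])
  change nent μ f ≤ _ at G
  rw [sum_law_mul μ f (fun z => Real.log (q z)), hexp (fun z => Real.log (q z))] at G
  have hlog : ∀ m, -∑ z : Fin n → Z, (∏ i, W.toZ (c.enc m i) (z i)) * Real.log (q z) ≤
      Real.log N - ∑ i, ∑ z, W.toZ (c.enc m i) z *
        Real.log (outPmf (Q (u (a m) i)) W.toZ z) := by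
    intro m
    have e1 : ∑ i, ∑ z, W.toZ (c.enc m i) z * Real.log (outPmf (Q (u (a m) i)) W.toZ z) =
        ∑ z : Fin n → Z, (∏ i, W.toZ (c.enc m i) (z i)) *
          ∑ i, Real.log (outPmf (Q (u (a m) i)) W.toZ (z i)) := by
      simp only [Finset.mul_sum]
      conv_rhs => rw [Finset.sum_comm]
      exact Finset.sum_congr rfl fun i _ => (sum_pi_apply (K := fun j => W.toZ (c.enc m j))
        (fun j => (W.toZ_mem _).2) i
        (fun z => Real.log (outPmf (Q (u (a m) i)) W.toZ z))).symm
    have e2 : Real.log N = ∑ z : Fin n → Z, (∏ i, W.toZ (c.enc m i) (z i)) * Real.log N := by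
      rw [← Finset.sum_mul, sum_pi_prod_eq_one fun i => (W.toZ_mem (c.enc m i)).2, one_mul]
    rw [e1]
    nth_rewrite 1 [e2]
    rw [← Finset.sum_sub_distrib, ← Finset.sum_neg_distrib]
    refine Finset.sum_le_sum fun z _ => ?_
    rcases eq_or_ne (∏ i, W.toZ (c.enc m i) (z i)) 0 with h0 | h0
    · simp [h0]
    have h1 : 0 < R (a m) z := Finset.prod_pos fun i _ => hRpos m z h0 i
    have h2 := Real.log_le_log (by positivity) (hqR (a m) z)
    rw [Real.log_mul (by positivity) h1.ne', one_div, Real.log_inv,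
      Real.log_prod fun i _ => (hRpos m z h0 i).ne'] at h2
    have h3 : 0 ≤ ∏ i, W.toZ (c.enc m i) (z i) :=
      Finset.prod_nonneg fun i _ => (W.toZ_mem _).1 _
    have h4 := mul_le_mul_of_nonneg_left h2 h3
    linarith
  have hsum := mul_le_mul_of_nonneg_left (Finset.sum_le_sum fun m (_ : m ∈ univ) => hlog m)
    (by positivity : 0 ≤ 1 / (M : ℝ))
  rw [Finset.sum_neg_distrib, mul_neg, Finset.sum_sub_distrib, Finset.sum_const, Finset.card_univ,
    Fintype.card_fin, nsmul_eq_mul, mul_sub, ← mul_assoc, one_div_mul_cancel hM'.ne',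
    one_mul] at hsum
  have hnoise : noiseEntropy W.toZ c.enc = -(1 / (M : ℝ) * ∑ m, ∑ i, ∑ z,
      W.toZ (c.enc m i) z * Real.log (W.toZ (c.enc m i) z)) := by
    simp only [noiseEntropy, Real.negMulLog, neg_mul, Finset.sum_neg_distrib, mul_neg]
  rw [hnoise]
  simp only [mul_sub, Finset.sum_sub_distrib] at hsum ⊢
  linarith

/-- Division by N is injective on a residue class and takes values in 0, …, (M − 1)/N; removing m
itself cancels the extra 1. -/
theorem card_cloud_le (m : Fin M) :
    #{m' : Fin M | m' ≠ m ∧ (m' : ℕ) % N = m % N} ≤ (M - 1) / N := by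
  classical
  have h1 : #{m' : Fin M | (m' : ℕ) % N = m % N} ≤ (M - 1) / N + 1 := by
    rw [← Finset.card_range ((M - 1) / N + 1)]
    refine Finset.card_le_card_of_injOn (fun m' => (m' : ℕ) / N) (fun m' _ => ?_) ?_
    · simp only [Finset.coe_range, Set.mem_Iio, Nat.lt_succ_iff]
      exact Nat.div_le_div_right (by omega)
    · intro x hx y hy hxy
      simp only [Finset.coe_filter, Finset.mem_univ, true_and, Set.mem_ofPred_eq] at hx hy
      refine Fin.ext ?_
      rw [← Nat.div_add_mod (x : ℕ) N, ← Nat.div_add_mod (y : ℕ) N, hx, hy]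
      simp only at hxy
      rw [hxy]
  have h2 : ({m' : Fin M | m' ≠ m ∧ (m' : ℕ) % N = m % N} : Finset (Fin M)) =
      ({m' : Fin M | (m' : ℕ) % N = m % N} : Finset (Fin M)).erase m := by
    ext m'
    simp
  rw [h2, Finset.card_erase_of_mem (by simp)]
  exact Nat.sub_le_iff_le_add.2 h1

end Disturbance

/-! ### Achievability -/

section Achievability

variable {U X Y Z : Type*} [Fintype U] [Fintype X] [Fintype Y] [Fintype Z]
  {P : U → ℝ} {Q : U → X → ℝ}

/-- Superposition codes: below the two information thresholds the error probability is small, and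
the disturbance is bounded through a cost `δ` that is small at the same time. -/
theorem exists_block_code (W : Channel X Y Z) (hP : P ∈ stdSimplex ℝ U)
    (hQ : ∀ u, Q u ∈ stdSimplex ℝ X) {t₁ t₂ : ℝ} (ht₁ : t₁ < chanInfo W.toY (outPmf P Q))
    (ht₂ : t₂ < ∑ u, P u * chanInfo W.toY (Q u)) :
    ∃ ρ₁ ρ₂ C : ℝ, 0 ≤ ρ₁ ∧ ρ₁ < 1 ∧ 0 ≤ ρ₂ ∧ ρ₂ < 1 ∧ ∀ (n M N L : ℕ) (a : Fin M → Fin N) (κ : ℝ),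
      0 < M → 0 < N → 0 ≤ κ → (∀ m, #{m' | m' ≠ m ∧ a m' = a m} ≤ L) →
      ∃ (c : Code X Y M n) (δ : ℝ), -(n * C) ≤ δ ∧
        nent (codePmf W c) (fun ω i => (ω.2 i).2) - noiseEntropy W.toZ c.enc ≤ Real.log N + δ ∧
        κ * errorProb W c + δ ≤
          κ * (ρ₁ ^ n + ρ₂ ^ n + ((M : ℝ) - 1) / Real.exp (n * t₁) + L / Real.exp (n * t₂)) +
            n * ∑ u, P u * chanInfo W.toZ (Q u) := by
  classical
  have hassoc : ∀ y, outPmf P (fun u => outPmf (Q u) W.toY) y = outPmf (outPmf P Q) W.toY y := by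
    intro y
    simp only [outPmf, Finset.mul_sum, Finset.sum_mul]
    rw [Finset.sum_comm]
    exact Finset.sum_congr rfl fun x _ => Finset.sum_congr rfl fun u _ => by ring
  have hpos2 : ∀ u x y, 0 < P u → 0 < Q u x → 0 < W.toY x y → 0 < outPmf (Q u) W.toY y :=
    fun u x y _ h2 h3 => (mul_pos h2 h3).trans_le
      (mul_le_outPmf (hQ u).1 (fun x => (W.toY_mem x).1) x y)
  obtain ⟨ρ₁, h10, h11, hT₁⟩ := exists_test_bound hP hQ W.toY_mem
    (fun _ => outPmf P (fun u => outPmf (Q u) W.toY)) (fun u x y h1 h2 h3 =>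
      (mul_pos h1 (hpos2 u x y h1 h2 h3)).trans_le (mul_le_outPmf hP.1
        (fun u => outPmf_nonneg (hQ u).1 fun x => (W.toY_mem x).1) u y)) (t := t₁) (by
      refine ht₁.trans_eq ?_
      rw [← sum_mul_log_sub_log (outPmf_mem hP hQ).2]
      simp only [hassoc]
      simp only [outPmf, Finset.sum_mul]
      rw [Finset.sum_comm]
      exact Finset.sum_congr rfl fun u _ => by
        rw [Finset.mul_sum]; exact Finset.sum_congr rfl fun x _ => by ring)
  obtain ⟨ρ₂, h20, h21, hT₂⟩ := exists_test_bound hP hQ W.toY_mem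
    (fun u => outPmf (Q u) W.toY) hpos2 (t := t₂) (by
      refine ht₂.trans_eq ?_
      simp only [sum_mul_log_sub_log (hQ _).2])
  -- The divergence of p(z|x) from p(z|u); its mean is I(X;Z|U) in nats.
  set d : U → X → ℝ := fun u x => ∑ z, W.toZ x z *
    (Real.log (W.toZ x z) - Real.log (outPmf (Q u) W.toZ z))
  refine ⟨ρ₁, ρ₂, ∑ u, ∑ x, |d u x|, h10, h11, h20, h21, fun n M N L a κ hM hN hκ hL => ?_⟩
  have hM' : (0 : ℝ) < M := by positivity
  obtain ⟨u, x, dec, hpos, hle⟩ := exists_superposition_code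
    (P := fun u : Fin n → U => ∏ i, P (u i))
    (Q := fun (u : Fin n → U) (x : Fin n → X) => ∏ i, Q (u i) (x i))
    (V := fun (x : Fin n → X) (y : Fin n → Y) => ∏ i, W.toY (x i) (y i)) (pi_prod_mem fun _ => hP)
    (fun u => pi_prod_mem fun i => hQ (u i)) (fun x => pi_prod_mem fun i => W.toY_mem (x i)) a hM
    (Real.exp_pos (n * t₁)) (Real.exp_pos (n * t₂)) L hL (fun (u : Fin n → U) (x : Fin n → X) => ∑ i, d (u i) (x i)) hκ
  have hout : ∀ (u : Fin n → U) (y : Fin n → Y), outPmf (fun x : Fin n → X => ∏ i, Q (u i) (x i))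
      (fun (x : Fin n → X) (y : Fin n → Y) => ∏ i, W.toY (x i) (y i)) y = ∏ i, outPmf (Q (u i)) W.toY (y i) := fun u y =>
    outPmf_pi (fun i => Q (u i)) W.toY y
  have hout' : ∀ y : Fin n → Y, outPmf (fun u : Fin n → U => ∏ i, P (u i))
      (fun u => outPmf (fun x : Fin n → X => ∏ i, Q (u i) (x i))
        (fun (x : Fin n → X) (y : Fin n → Y) => ∏ i, W.toY (x i) (y i))) y =
      ∏ i, outPmf P (fun u => outPmf (Q u) W.toY) (y i) := fun y => by
    rw [← outPmf_pi (fun _ => P) (fun u => outPmf (Q u) W.toY) y]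
    exact Finset.sum_congr rfl fun u _ =>
      congrArg (fun s => (∏ i, P (u i)) * s) (hout u y)
  refine ⟨⟨x, dec⟩, 1 / (M : ℝ) * ∑ m, ∑ i, d (u (a m) i) (x m i), ?_, ?_, ?_⟩
  · have hd : ∀ u x, -(∑ u, ∑ x, |d u x|) ≤ d u x := fun u x => by
      have h1 : |d u x| ≤ ∑ x, |d u x| :=
        Finset.single_le_sum (f := fun x => |d u x|) (fun _ _ => abs_nonneg _) (Finset.mem_univ x)
      have h2 : ∑ x, |d u x| ≤ ∑ u, ∑ x, |d u x| :=
        Finset.single_le_sum (f := fun u => ∑ x, |d u x|)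
          (fun _ _ => Finset.sum_nonneg fun _ _ => abs_nonneg _) (Finset.mem_univ u)
      linarith [neg_abs_le (d u x)]
    have h3 : -(n * ∑ u, ∑ x, |d u x|) =
        1 / (M : ℝ) * ∑ _m : Fin M, ∑ _i : Fin n, -(∑ u, ∑ x, |d u x|) := by
      simp only [Finset.sum_const, Finset.card_univ, Fintype.card_fin, nsmul_eq_mul]
      field_simp
    rw [h3]
    exact mul_le_mul_of_nonneg_left (Finset.sum_le_sum fun m _ => Finset.sum_le_sum fun i _ =>
      hd _ _) (by positivity)
  · refine nent_sub_noiseEntropy_le W ⟨x, dec⟩ hM hN hQ a u fun m i => ?_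
    refine ((hQ _).1 _).lt_of_ne' fun h0 => (hpos m).ne' ?_
    exact Finset.prod_eq_zero (Finset.mem_univ i) h0
  · rw [errorProb_eq_average]
    refine hle.trans ?_
    simp only [hout, hout', mul_add, Finset.sum_add_distrib]
    have e : ∑ u : Fin n → U, (∏ i, P (u i)) * ∑ x : Fin n → X, (∏ i, Q (u i) (x i)) *
        ∑ i, d (u i) (x i) = n * ∑ u, P u * chanInfo W.toZ (Q u) := by
      rw [sum_pi_cost hP hQ d]
      simp only [d, sum_mul_log_sub_log (hQ _).2]
    have g1 := mul_le_mul_of_nonneg_left (hT₁ n) hκ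
    have g2 := mul_le_mul_of_nonneg_left (hT₂ n) hκ
    rw [e]
    linarith

theorem numMessages_pos (R : ℝ) (n : ℕ) : 0 < numMessages R n :=
  Nat.ceil_pos.2 (by positivity)

theorem numMessages_sub_one_le (R : ℝ) (n : ℕ) :
    (numMessages R n : ℝ) - 1 ≤ Real.exp (n * (R * Real.log 2)) := by
  have h := Nat.ceil_lt_add_one (by positivity : (0 : ℝ) ≤ (2 : ℝ) ^ ((n : ℝ) * R))
  have e : (2 : ℝ) ^ ((n : ℝ) * R) = Real.exp (n * (R * Real.log 2)) := by
    rw [Real.rpow_def_of_pos (by norm_num)]; ring_nf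
  rw [e] at h
  rw [numMessages, e]
  linarith

theorem exp_le_numMessages (R : ℝ) (n : ℕ) :
    Real.exp (n * (R * Real.log 2)) ≤ numMessages R n := by
  have e : (2 : ℝ) ^ ((n : ℝ) * R) = Real.exp (n * (R * Real.log 2)) := by
    rw [Real.rpow_def_of_pos (by norm_num)]; ring_nf
  rw [← e]
  exact Nat.le_ceil _

/-- Since 2^{nR} ≥ 1 for R ≥ 0, rounding up at most doubles it. -/
theorem log_numMessages_le {R : ℝ} (hR : 0 ≤ R) (n : ℕ) :
    Real.log (numMessages R n) ≤ n * (R * Real.log 2) + Real.log 2 := by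
  have hlog : 0 < Real.log 2 := Real.log_pos (by norm_num)
  have h1 : (numMessages R n : ℝ) ≤ Real.exp (n * (R * Real.log 2)) * 2 := by
    have h2 : 1 ≤ Real.exp (n * (R * Real.log 2)) := Real.one_le_exp (by positivity)
    linarith [numMessages_sub_one_le R n]
  have hpos : (0 : ℝ) < numMessages R n := by exact_mod_cast numMessages_pos R n
  refine (Real.log_le_log hpos h1).trans_eq ?_
  rw [Real.log_mul (Real.exp_pos _).ne' (by norm_num), Real.log_exp]

open Filter in
theorem achievable_of_superposition (W : Channel X Y Z) (hP : P ∈ stdSimplex ℝ U)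
    (hQ : ∀ u, Q u ∈ stdSimplex ℝ X) {R R₀ D ε : ℝ} (hR : 0 ≤ R) (hR₀ : 0 ≤ R₀) (hD₀ : 0 ≤ D)
    (hε : 0 < ε) (h₁ : (R + ε) * Real.log 2 < chanInfo W.toY (outPmf P Q))
    (h₂ : (R - R₀ + ε) * Real.log 2 < ∑ u, P u * chanInfo W.toY (Q u))
    (hD : R₀ + (∑ u, P u * chanInfo W.toZ (Q u)) / Real.log 2 ≤ D) : Achievable W R D := by
  have hlog : 0 < Real.log 2 := Real.log_pos (by norm_num)
  obtain ⟨ρ₁, ρ₂, C, h10, h11, h20, h21, hcode⟩ := exists_block_code W hP hQ h₁ h₂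
  set I := ∑ u, P u * chanInfo W.toZ (Q u)
  set ρ₀ := Real.exp (-(ε * Real.log 2))
  have h00 : 0 ≤ ρ₀ := (Real.exp_pos _).le
  have h01 : ρ₀ < 1 := Real.exp_lt_one_iff.2 (by have := mul_pos hε hlog; linarith)
  -- Two failed tests and two kinds of rivals; each rival term is at most 2^{-nε}.
  set b : ℕ → ℝ := fun n => ρ₁ ^ n + ρ₂ ^ n + ρ₀ ^ n + ρ₀ ^ n
  have hb0 : Tendsto b atTop (nhds 0) := by
    have := (((tendsto_pow_atTop_nhds_zero_of_lt_one h10 h11).add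
      (tendsto_pow_atTop_nhds_zero_of_lt_one h20 h21)).add
      (tendsto_pow_atTop_nhds_zero_of_lt_one h00 h01)).add
      (tendsto_pow_atTop_nhds_zero_of_lt_one h00 h01)
    simpa using this
  have hb1 : Tendsto (fun n : ℕ => (n : ℝ) * b n) atTop (nhds 0) := by
    have := (((tendsto_self_mul_const_pow_of_lt_one h10 h11).add
      (tendsto_self_mul_const_pow_of_lt_one h20 h21)).add
      (tendsto_self_mul_const_pow_of_lt_one h00 h01)).add
      (tendsto_self_mul_const_pow_of_lt_one h00 h01)
    simpa [b, mul_add] using this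
  have key : ∀ n : ℕ, ∃ c : Code X Y (numMessages R n) n, 0 < n →
      errorProb W c ≤ b n + (I + C) / n ∧
      disturbanceRate W c ≤ R₀ + 1 / n + (n * b n + I) / Real.log 2 := by
    intro n
    have hM := numMessages_pos R n
    have hN := numMessages_pos R₀ n
    -- The weight n² balances both goals: δ ≥ −nC makes the error at most b n + (I + C)/n, while n²
    -- · b n is still o(n), so δ/n is asymptotically at most I.
    obtain ⟨c, δ, hδ, hdist, hcost⟩ := hcode n (numMessages R n) (numMessages R₀ n)
      ((numMessages R n - 1) / numMessages R₀ n)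
      (fun m => ⟨(m : ℕ) % numMessages R₀ n, Nat.mod_lt _ hN⟩) ((n : ℝ) ^ 2) hM hN (by positivity)
      (fun m => by simpa only [Fin.mk.injEq] using card_cloud_le m)
    refine ⟨c, fun hn => ?_⟩
    have hn' : (0 : ℝ) < n := by positivity
    have hN' : (0 : ℝ) < numMessages R₀ n := by exact_mod_cast hN
    have hρ : ρ₀ ^ n = Real.exp (-(n * (ε * Real.log 2))) := by
      rw [← Real.exp_nat_mul]; ring_nf
    have c1 : ((numMessages R n : ℝ) - 1) / Real.exp (n * ((R + ε) * Real.log 2)) ≤ ρ₀ ^ n := by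
      rw [div_le_iff₀ (Real.exp_pos _), hρ, ← Real.exp_add]
      refine (numMessages_sub_one_le R n).trans_eq ?_
      ring_nf
    have c2 : (((numMessages R n - 1) / numMessages R₀ n : ℕ) : ℝ) /
        Real.exp (n * ((R - R₀ + ε) * Real.log 2)) ≤ ρ₀ ^ n := by
      rw [div_le_iff₀ (Real.exp_pos _), hρ, ← Real.exp_add]
      refine Nat.cast_div_le.trans ?_
      rw [Nat.cast_sub hM, Nat.cast_one, div_le_iff₀ hN']
      refine (numMessages_sub_one_le R n).trans ((le_of_eq ?_).trans
        (mul_le_mul_of_nonneg_left (exp_le_numMessages R₀ n) (Real.exp_pos _).le))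
      rw [← Real.exp_add]
      ring_nf
    have hcost' : (n : ℝ) ^ 2 * errorProb W c + δ ≤ (n : ℝ) ^ 2 * b n + n * I := by
      refine hcost.trans (add_le_add_left (mul_le_mul_of_nonneg_left ?_ (by positivity)) _)
      simp only [b]
      linarith
    constructor
    · have h1 : (n : ℝ) ^ 2 * errorProb W c ≤ (n : ℝ) ^ 2 * (b n + (I + C) / n) := by
        have : (n : ℝ) ^ 2 * (b n + (I + C) / n) = (n : ℝ) ^ 2 * b n + n * I + n * C := by
          field_simp
          ring
        linarith
      exact le_of_mul_le_mul_left h1 (by positivity)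
    · have h1 : δ ≤ (n : ℝ) ^ 2 * b n + n * I := by
        have := mul_nonneg (sq_nonneg (n : ℝ)) (errorProb_nonneg W c)
        linarith
      have h2 := log_numMessages_le hR₀ n
      have h3 : disturbanceRate W c = 1 / n * ((nent (codePmf W c) (fun ω i => (ω.2 i).2) -
          noiseEntropy W.toZ c.enc) / Real.log 2) := by
        rw [disturbanceRate, mutualInfo_codePmf W c Prod.snd]
        rfl
      have h4 : R₀ + 1 / n + (n * b n + I) / Real.log 2 = 1 / n * ((n * (R₀ * Real.log 2) +
          Real.log 2 + ((n : ℝ) ^ 2 * b n + n * I)) / Real.log 2) := by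
        field_simp
      rw [h3, h4]
      refine mul_le_mul_of_nonneg_left (div_le_div_of_nonneg_right ?_ hlog.le) (by positivity)
      linarith
  choose c hc using key
  refine ⟨hR, hD₀, c, ?_, ?_⟩
  · have hlim : Tendsto (fun n : ℕ => b n + (I + C) / n) atTop (nhds 0) := by
      simpa using hb0.add (tendsto_const_div_atTop_nhds_zero_nat (I + C))
    refine tendsto_of_tendsto_of_tendsto_of_le_of_le' tendsto_const_nhds hlim
      (Eventually.of_forall fun n => errorProb_nonneg W (c n)) ?_
    filter_upwards [eventually_gt_atTop 0] with n hn using (hc n hn).1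
  · have hlim : Tendsto (fun n : ℕ => R₀ + 1 / n + (n * b n + I) / Real.log 2) atTop
        (nhds (R₀ + I / Real.log 2)) := by
      simpa using ((tendsto_one_div_atTop_nhds_zero_nat (𝕜 := ℝ)).const_add R₀).add
        ((hb1.add_const I).div_const (Real.log 2))
    have hlimE : Tendsto (fun n : ℕ => ((R₀ + 1 / n + (n * b n + I) / Real.log 2 : ℝ) : EReal))
        atTop (nhds ((R₀ + I / Real.log 2 : ℝ) : EReal)) :=
      (continuous_coe_real_ereal.tendsto _).comp hlim
    calc limsup (fun n => (disturbanceRate W (c n) : EReal)) atTop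
        ≤ limsup (fun n : ℕ => ((R₀ + 1 / n + (n * b n + I) / Real.log 2 : ℝ) : EReal)) atTop := by
          refine limsup_le_limsup ?_
          filter_upwards [eventually_gt_atTop 0] with n hn
          exact_mod_cast (hc n hn).2
      _ = ((R₀ + I / Real.log 2 : ℝ) : EReal) := hlimE.limsup_eq
      _ ≤ (D : EReal) := by exact_mod_cast hD

/-- A constant codeword carries no information. At R = 0 the rate cannot be lowered to gain slack,
so this case needs its own code. -/
theorem achievable_zero (W : Channel X Y Z) (x : X) {D : ℝ} (hD : 0 ≤ D) : Achievable W 0 D := by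
  have hone : ∀ n, numMessages 0 n = 1 := fun n => by simp [numMessages]
  have hsub : ∀ n, Subsingleton (Fin (numMessages 0 n)) := fun n => by
    rw [hone]; infer_instance
  refine ⟨le_rfl, hD, fun n => ⟨fun _ _ => x, fun _ => ⟨0, numMessages_pos 0 n⟩⟩, ?_, ?_⟩
  · refine tendsto_const_nhds.congr fun n => ?_
    have := hsub n
    rw [errorProb, Finset.filter_false_of_mem, Finset.sum_empty]
    exact fun ω _ h => h (Subsingleton.elim _ _)
  · have hzero : ∀ n, disturbanceRate W (M := numMessages 0 n) (n := n)
        ⟨fun _ _ => x, fun _ => ⟨0, numMessages_pos 0 n⟩⟩ = 0 := by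
      intro n
      rw [disturbanceRate, mutualInfo, condEntropy, entropy_eq_nent, entropy_eq_nent,
        entropy_eq_nent, nent_const (codePmf_mem W _ (numMessages_pos 0 n)).2 fun ω ω' => rfl,
        nent_congr (f := fun ω : Fin (numMessages 0 n) × (Fin n → Y × Z) =>
          ((fun _ => x : Fin n → X), fun i => (ω.2 i).2)) (g := fun ω i => (ω.2 i).2)]
      · simp
      · simp
    simp only [hzero]
    rw [Filter.limsup_const]
    exact_mod_cast hD

theorem subset_region (W : Channel X Y Z) {p : U × X → ℝ} (hp : p ∈ stdSimplex ℝ (U × X))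
    {R D : ℝ} (hR : 0 ≤ R) (hD : 0 ≤ D) (h₁ : R ≤ infoXY W p) (h₂ : infoXZgivenU W p ≤ D)
    (h₃ : R - D ≤ infoXYgivenU W p - infoXZgivenU W p) :
    (R, D) ∈ rateDisturbanceRegion W := by
  have hlog : 0 < Real.log 2 := Real.log_pos (by norm_num)
  obtain ⟨⟨u₀, x₀⟩, -, -⟩ : ∃ a ∈ univ, p a ≠ 0 := Finset.exists_ne_zero_of_sum_ne_zero (by
    rw [hp.2]; exact one_ne_zero)
  rcases hR.eq_or_lt with rfl | hR
  · exact subset_closure (achievable_zero W x₀ hD)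
  classical
  set P : U → ℝ := fun u => ∑ x, p (u, x)
  -- On values u of probability zero the conditional law is set to a point mass, so that `Q u` is
  -- always a pmf.
  set Q : U → X → ℝ := fun u x => if P u = 0 then (if x = x₀ then 1 else 0) else p (u, x) / P u
  have hP : P ∈ stdSimplex ℝ U :=
    ⟨fun u => Finset.sum_nonneg fun x _ => hp.1 _, by rw [← hp.2, Fintype.sum_prod_type]⟩
  have hQ : ∀ u, Q u ∈ stdSimplex ℝ X := fun u => by
    by_cases h : P u = 0
    · exact ⟨fun x => by simp only [Q, if_pos h]; split_ifs <;> norm_num, by simp [Q, h]⟩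
    · refine ⟨fun x => by simp only [Q, if_neg h]; exact div_nonneg (hp.1 _) (hP.1 u), ?_⟩
      simp only [Q, if_neg h, ← Finset.sum_div]
      exact div_self h
  have hPQ : ∀ u x, P u * Q u x = p (u, x) := fun u x => by
    by_cases h : P u = 0
    · rw [h, zero_mul]
      exact ((Finset.sum_eq_zero_iff_of_nonneg fun x _ => hp.1 (u, x)).1 h x
        (Finset.mem_univ x)).symm
    · simp only [Q, if_neg h]
      exact mul_div_cancel₀ _ h
  have hY : ∀ u, P u * chanInfo W.toY (Q u) = chanInfo W.toY (fun x => p (u, x)) := fun u => by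
    rw [← chanInfo_smul fun x => (W.toY_mem x).2]; simp only [hPQ]
  have hZ : ∀ u, P u * chanInfo W.toZ (Q u) = chanInfo W.toZ (fun x => p (u, x)) := fun u => by
    rw [← chanInfo_smul fun x => (W.toZ_mem x).2]; simp only [hPQ]
  have hout : outPmf P Q = fun x => ∑ u, p (u, x) := by
    ext x
    simp only [outPmf, hPQ]
  rw [infoXY_eq W hp.2, ← hout] at h₁
  have e2 : infoXYgivenU W p = (∑ u, P u * chanInfo W.toY (Q u)) / Real.log 2 := by
    rw [infoXYgivenU_eq]; simp only [hY]
  have e3 : infoXZgivenU W p = (∑ u, P u * chanInfo W.toZ (Q u)) / Real.log 2 := by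
    rw [infoXZgivenU_eq]; simp only [hZ]
  refine Metric.mem_closure_iff.2 fun η hη => ?_
  -- The bound R/4 keeps the lowered rate R − 2ε nonnegative; η/4 keeps it within η of R.
  set ε := min (η / 4) (R / 4)
  have hε : 0 < ε := lt_min (by positivity) (by positivity)
  have hε1 : ε ≤ η / 4 := min_le_left _ _
  have hε2 : ε ≤ R / 4 := min_le_right _ _
  -- This R₀ is the least nonnegative cloud rate with R − R₀ ≤ I(X;Y|U). The two cases of the
  -- maximum turn R₀ + I(X;Z|U) ≤ D into `h₂` and `h₃`.
  refine ⟨(R - 2 * ε, D), achievable_of_superposition W hP hQ (R₀ := max 0 (R - infoXYgivenU W p))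
    (ε := ε) (by linarith) (le_max_left _ _) hD hε ?_ ?_ ?_, ?_⟩
  · rw [← lt_div_iff₀ hlog]
    linarith
  · rw [← lt_div_iff₀ hlog, ← e2]
    have := le_max_right 0 (R - infoXYgivenU W p)
    linarith
  · rw [← e3]
    rcases max_cases 0 (R - infoXYgivenU W p) with h | h <;> rw [h.1] <;> linarith
  · rw [Prod.dist_eq, dist_self, Real.dist_eq, max_lt_iff]
    refine ⟨?_, hη⟩
    rw [abs_lt]
    constructor <;> linarith

end Achievability

end DisturbanceChannel

theorem mainTheorem1 {X Y Z : Type*} [Fintype X] [Fintype Y] [Fintype Z]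
    (W : DisturbanceChannel.Channel X Y Z) :
    DisturbanceChannel.rateDisturbanceRegion W =
      {r : ℝ × ℝ | 0 ≤ r.1 ∧ 0 ≤ r.2 ∧
        ∃ k : ℕ, k ≤ Fintype.card X + 1 ∧ ∃ p ∈ stdSimplex ℝ (Fin k × X),
          r.1 ≤ DisturbanceChannel.infoXY W p ∧
          DisturbanceChannel.infoXZgivenU W p ≤ r.2 ∧
          r.1 - r.2 ≤
            DisturbanceChannel.infoXYgivenU W p - DisturbanceChannel.infoXZgivenU W p} := by
  ext r
  constructor
  · intro hr
    obtain ⟨h1, h2, h3⟩ := DisturbanceChannel.region_subset W hr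
    exact ⟨h1, h2, _, le_rfl, h3⟩
  · rintro ⟨h1, h2, k, -, p, hp, h3, h4, h5⟩
    exact DisturbanceChannel.subset_region W hp h1 h2 h3 h4 h5
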